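/- All graphs are finite, undirected, without loops or multiple edges. Let $G$ be a 2-connected graph of order $n$ (that is, $n\ge 3$ and $G$ stays connected after the deletion of any set of at most one vertex). Let $c$ be the circumference of $G$ (the number of vertices of a longest cycle), let $p$ be the number of vertices of a longest path in $G$, and let $\delta$ be the minimum degree of $G$. Then $$ c\ \ge\ B,\qquad\text{where}\qquad B=\begin{cases} p & \text{if } p\le 2\delta,\\ p-1 & \text{if } 2\delta+1\le p\le 3\delta-2,\\ \sqrt{2p-10+\left(\delta-\tfrac72\right)^2}+\delta+\tfrac12 & \text{if } p\ge 3\delta-1.\end{cases} $$ Consequently this is a common generalization of two bounds of Dirac: $c\ge\min\{n,2\delta\}$, and, strictly strengthening $c\ge\sqrt{2p}$, in each of the three ranges $B>\sqrt{2p}$. -/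

import Mathlib

namespace SimpleGraph

/-- A graph is `k`-connected if it has more than `k` vertices and deleting any set of fewer than
`k` vertices leaves a connected graph. -/
def IsVertexConnected {V : Type*} (G : SimpleGraph V) (k : ℕ) : Prop :=
  k < Nat.card V ∧ ∀ s : Finset V, s.card < k → (G.induce ((s : Set V)ᶜ)).Connected

/-- The circumference: the largest order of a cycle. The order of a cycle equals its length. On a
finite graph the set of these orders is bounded, so for a graph with a cycle this is a maximum. -/
noncomputable def circumference {V : Type*} (G : SimpleGraph V) : ℕ :=
  sSup {k : ℕ | ∃ (v : V) (w : G.Walk v v), w.IsCycle ∧ w.length = k}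

/-- The order (number of vertices) of a longest path; a path of length `l` has `l + 1` vertices.
On a finite nonempty graph this is a maximum. -/
noncomputable def longestPathOrder {V : Type*} (G : SimpleGraph V) : ℕ :=
  sSup {k : ℕ | ∃ (u v : V) (w : G.Walk u v), w.IsPath ∧ w.length + 1 = k}

end SimpleGraph

/-! Choose a longest path with an initial segment spanning a cycle: a lollipop with cycle `C` and
tail `R`, where `C` is as long as possible. If `R` is empty then `p ≤ c`. Otherwise `|C| ≥ 2δ`
(`two_mul_le_length`): if not, an exchange argument of Ore type confines the neighbours of every
vertex of `C` except the attachment vertex to `C`, and the attachment vertex separates the graph. If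
`|R| ≥ 2`, the neighbours on `C` of the two ends of `R` are far apart, since otherwise `R` could be
routed into a longer cycle; counting gaps gives `3δ ≤ p + 1` (`three_mul_le`). So `p ≤ 3δ - 2`
forces `|R| ≤ 1` and `c ≥ p - 1`.

For `p ≥ 3δ - 1` and `p > c`, 2-connectivity supplies a vine on a longest path: `m` disjoint paths
bridging consecutive overlapping intervals. For `m ≥ 3` the outer members can be adjusted so that
the cycle through all members contains every neighbour of both ends of the path, whence `m ≤ c - 2δ
+ 2` (`exists_le_vineSum`). Cycles through nested runs of members bound the doubly covered segments
in pairs, and so bound `p` in terms of `m` and `c` (`length_le_of_odd`,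
`two_mul_length_le_of_even`). Together these give `2p ≤ c(c - 2δ - 1) + 8δ - 2`
(`circumference_quadratic`), which is the third bound after completing the square. -/

namespace SimpleGraph

/-! ### Paths and cycles as vertex lists; consequences of 2-connectivity -/

theorem _root_.List.IsChain.of_isInfix {α : Type*} {r : α → α → Prop} {l l₁ : List α}
    (h : l.IsChain r) (hl : l₁ <:+: l) : l₁.IsChain r := by
  obtain ⟨a, b, rfl⟩ := hl
  exact (List.isChain_append.1 (List.isChain_append.1 h).1).2.1

/-- The list of vertices of a path. -/
def IsPathList {V : Type*} (G : SimpleGraph V) (l : List V) : Prop :=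
  l.IsChain G.Adj ∧ l.Nodup

/-- The list of vertices of a cycle, in cyclic order. -/
def IsCycleList {V : Type*} (G : SimpleGraph V) (l : List V) : Prop :=
  3 ≤ l.length ∧ l.Nodup ∧ (l ++ l).IsChain G.Adj

variable {V : Type*} {G : SimpleGraph V}

theorem isChain_adj_reverse {l : List V} : l.reverse.IsChain G.Adj ↔ l.IsChain G.Adj := by
  rw [List.isChain_reverse]
  constructor <;> exact fun h => h.imp fun _ _ hab => hab.symm

theorem IsPathList.reverse {l : List V} (h : G.IsPathList l) : G.IsPathList l.reverse :=
  ⟨isChain_adj_reverse.2 h.1, List.nodup_reverse.2 h.2⟩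

theorem IsCycleList.append_comm {a b : List V} (h : G.IsCycleList (a ++ b)) :
    G.IsCycleList (b ++ a) := by
  obtain ⟨h3, hn, hc⟩ := h
  refine ⟨by simp at h3 ⊢; omega, List.nodup_append_comm.1 hn, ?_⟩
  rcases eq_or_ne a [] with rfl | ha
  · simpa using hc
  rcases eq_or_ne b [] with rfl | hb
  · simpa using hc
  have h1 : (b ++ a).IsChain G.Adj := hc.of_isInfix ⟨a, b, by simp⟩
  have h2 : (a ++ b).IsChain G.Adj := hc.of_isInfix ⟨[], a ++ b, by simp⟩
  rw [List.isChain_append]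
  refine ⟨h1, h1, ?_⟩
  have := (List.isChain_append.1 h2).2.2
  intro x hx y hy
  apply this
  · simpa [List.getLast?_append, ha, Option.or_of_isSome] using hx
  · simpa [List.head?_append, hb] using hy

theorem IsCycleList.isPathList {l : List V} (h : G.IsCycleList l) : G.IsPathList l :=
  ⟨(List.isChain_append.1 h.2.2).1, h.2.1⟩

theorem isCycleList_iff {l : List V} : G.IsCycleList l ↔
    3 ≤ l.length ∧ G.IsPathList l ∧ ∀ x ∈ l.getLast?, ∀ y ∈ l.head?, G.Adj x y := by
  unfold IsCycleList IsPathList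
  rw [List.isChain_append]
  tauto

theorem IsPathList.exists_walk {l : List V} (h : G.IsPathList l) (hl : l ≠ []) :
    ∃ w : G.Walk (l.head hl) (l.getLast hl), w.IsPath ∧ w.support = l :=
  ⟨.ofSupport l hl h.1, by
    rw [Walk.isPath_def, Walk.support_ofSupport]; exact ⟨h.2, rfl⟩⟩

theorem IsPathList.length_le_longestPathOrder [Fintype V] {l : List V} (h : G.IsPathList l) :
    l.length ≤ G.longestPathOrder := by
  rcases eq_or_ne l [] with rfl | hl
  · simp
  obtain ⟨w, hw, hs⟩ := h.exists_walk hl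
  refine le_csSup ⟨Fintype.card V, ?_⟩ ⟨_, _, w, hw, by rw [← Walk.length_support, hs]⟩
  rintro k ⟨u, v, w, hw, rfl⟩
  exact hw.length_lt

theorem exists_isPathList_length_eq [Fintype V] [Nonempty V] :
    ∃ l, G.IsPathList l ∧ l.length = G.longestPathOrder := by
  have hne : {k : ℕ | ∃ (u v : V) (w : G.Walk u v), w.IsPath ∧ w.length + 1 = k}.Nonempty :=
    ⟨1, Classical.arbitrary V, _, Walk.nil, by simp⟩
  obtain ⟨u, v, w, hw, hk⟩ := Nat.sSup_mem hne ⟨Fintype.card V, by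
    rintro k ⟨u, v, w, hw, rfl⟩
    exact hw.length_lt⟩
  exact ⟨w.support, ⟨w.isChain_adj_support, hw.support_nodup⟩, by
    rw [Walk.length_support, hk]; rfl⟩

theorem IsCycleList.length_le_circumference [Fintype V] {l : List V} (h : G.IsCycleList l) :
    l.length ≤ G.circumference := by
  obtain ⟨h3, hp, ha⟩ := isCycleList_iff.1 h
  have hl : l ≠ [] := by rintro rfl; simp at h3
  obtain ⟨w, hw, hs⟩ := hp.exists_walk hl
  have hadj : G.Adj (l.getLast hl) (l.head hl) :=
    ha _ (by simp [List.getLast?_eq_some_getLast hl]) _ (by simp [List.head?_eq_some_head hl])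
  have hlen : w.length + 1 = l.length := by rw [← Walk.length_support, hs]
  refine le_csSup ⟨Fintype.card V, ?_⟩ ⟨_, .cons hadj w, ?_, by simpa using hlen⟩
  · rintro k ⟨v, w, hw, rfl⟩
    have h1 := hw.support_nodup
    have h2 := h1.length_le_card
    simpa using h2
  · rw [Walk.cons_isCycle_iff]
    refine ⟨hw, fun hmem => ?_⟩
    have := hw.length_eq_one_of_mem_edges (Sym2.eq_swap ▸ hmem)
    omega

/-- In a 2-connected graph, a set with a vertex other than `a` inside and outside has an edge
leaving it that avoids `a`. -/
theorem IsVertexConnected.exists_adj (hG : G.IsVertexConnected 2) (a : V) (S : Set V)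
    {x y : V} (hx : x ∈ S) (hxa : x ≠ a) (hy : y ∉ S) (hya : y ≠ a) :
    ∃ u ∈ S, ∃ v ∉ S, u ≠ a ∧ v ≠ a ∧ G.Adj u v := by
  have hc := hG.2 {a} (by simp)
  obtain ⟨w⟩ := hc.preconnected ⟨x, by simpa using hxa⟩ ⟨y, by simpa using hya⟩
  by_contra! hcon
  suffices ∀ (p q : ((({a} : Finset V) : Set V)ᶜ : Set V)),
      (G.induce ((({a} : Finset V) : Set V)ᶜ)).Walk p q → (p : V) ∈ S → (q : V) ∈ S from
    hy (this _ _ w hx)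
  intro p q w
  induction w with
  | nil => exact id
  | @cons u v w h _ ih =>
    intro hu
    refine ih ?_
    by_contra hv
    exact hcon u hu v hv (by simpa using u.2) (by simpa using v.2) h

theorem IsVertexConnected.two_le_degree [Fintype V] [DecidableRel G.Adj]
    (hG : G.IsVertexConnected 2) (v : V) : 2 ≤ G.degree v := by
  by_contra! hlt
  have h3 : 2 < Fintype.card V := by simpa [Nat.card_eq_fintype_card] using hG.1
  obtain ⟨a, hva, ha⟩ : ∃ a, v ≠ a ∧ ∀ u, G.Adj v u → u = a := by
    rw [← card_neighborFinset_eq_degree] at hlt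
    rcases (G.neighborFinset v).eq_empty_or_nonempty with he | ⟨a, ha⟩
    · obtain ⟨a, ha⟩ := Fintype.exists_ne_of_one_lt_card (by omega) v
      refine ⟨a, ha.symm, fun u hu => ?_⟩
      have : u ∈ G.neighborFinset v := by simpa using hu
      simp [he] at this
    · refine ⟨a, G.ne_of_adj (by simpa using ha), fun u hu => ?_⟩
      exact Finset.card_le_one.1 (by omega) u (by simpa using hu) a ha
  classical
  obtain ⟨y, hy⟩ : ∃ y, y ∉ ({v, a} : Finset V) := by
    by_contra! h
    have := Finset.card_le_card (fun x _ => h x : Finset.univ ⊆ ({v, a} : Finset V))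
    have := Finset.card_le_two (a := v) (b := a)
    simp at *
    omega
  simp at hy
  obtain ⟨u, hu, w, -, -, hwa, huw⟩ := hG.exists_adj a {v} (x := v) (y := y) rfl hva
    (by simpa using hy.1) hy.2
  obtain rfl : u = v := hu
  exact hwa (ha w huw)


/-! ### Maximal lollipops and the bound `2δ` -/

theorem _root_.List.getLast?_cons_concat {α : Type*} (x a : α) (l : List α) :
    (x :: (l ++ [a])).getLast? = some a := by
  rw [← List.cons_append, List.getLast?_concat]

/-- The cycle `C`, whose last vertex is joined to the first vertex of the path `R` unless `R` is
empty; `C ++ R` is a path. -/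
structure IsLollipop (G : SimpleGraph V) (C R : List V) : Prop where
  path : G.IsPathList (C ++ R)
  cycle : G.IsCycleList C

/-- A lollipop spanning a longest path, with its cycle as long as possible. -/
structure IsMaxLollipop (G : SimpleGraph V) (C R : List V) : Prop extends G.IsLollipop C R where
  length_le : ∀ l, G.IsPathList l → l.length ≤ (C ++ R).length
  cycle_length_le : ∀ C' R', G.IsLollipop C' R' → (C' ++ R').length = (C ++ R).length →
    C'.length ≤ C.length

theorem IsPathList.mem_of_adj_head {x y : V} {l : List V} (h : G.IsPathList (x :: l))
    (hmax : ∀ l', G.IsPathList l' → l'.length ≤ (x :: l).length) (hxy : G.Adj x y) : y ∈ l := by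
  by_contra hy
  have := hmax (y :: x :: l) ⟨List.isChain_cons_cons.2 ⟨hxy.symm, h.1⟩,
    List.nodup_cons.2 ⟨by simp [hxy.ne', hy], h.2⟩⟩
  simp at this

/-- All neighbours of the first vertex of a longest path lie on that path. A neighbour other than
its successor closes a cycle, so lollipops exist. -/
theorem exists_isMaxLollipop [Fintype V] [DecidableRel G.Adj] [Nonempty V]
    (hδ : ∀ v, 2 ≤ G.degree v) :
    ∃ C R, G.IsMaxLollipop C R ∧ (C ++ R).length = G.longestPathOrder := by
  classical
  obtain ⟨l, hl, hlen⟩ := exists_isPathList_length_eq (G := G)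
  have hmax : ∀ l', G.IsPathList l' → l'.length ≤ l.length := fun l' h' =>
    hlen ▸ h'.length_le_longestPathOrder
  have hex : ∃ C R, G.IsLollipop C R ∧ (C ++ R).length = l.length := by
    match l with
    | [] =>
      have := hmax [Classical.arbitrary V] ⟨by simp, by simp⟩
      simp at this
    | [x] =>
      obtain ⟨y, hy⟩ := (G.degree_pos_iff_exists_adj x).1 (by have := hδ x; omega)
      simpa using hl.mem_of_adj_head hmax hy
    | x :: y :: l =>
      obtain ⟨z, hz, hzy⟩ : ∃ z ∈ G.neighborFinset x, z ≠ y :=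
        Finset.exists_mem_ne (by have := hδ x; rw [card_neighborFinset_eq_degree]; omega) y
      rw [mem_neighborFinset] at hz
      have hzl : z ∈ l := by simpa [hzy] using hl.mem_of_adj_head hmax hz
      obtain ⟨l₁, l₂, rfl⟩ := List.append_of_mem hzl
      refine ⟨x :: y :: (l₁ ++ [z]), l₂, ⟨by simpa using hl, ?_⟩, by simp⟩
      rw [isCycleList_iff]
      refine ⟨by simp, ⟨hl.1.of_isInfix ⟨[], l₂, by simp⟩, hl.2.sublist
        (List.IsInfix.sublist ⟨[], l₂, by simp⟩)⟩, ?_⟩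
      rw [← List.cons_append, List.getLast?_cons_concat]
      simpa using hz.symm
  have hex' : ∃ k, ∃ C R, (G.IsLollipop C R ∧ (C ++ R).length = l.length) ∧ C.length = k := by
    obtain ⟨C, R, h⟩ := hex
    exact ⟨_, C, R, h, rfl⟩
  have hb : ∀ k, (∃ C R, (G.IsLollipop C R ∧ (C ++ R).length = l.length) ∧ C.length = k) →
      k ≤ l.length := by
    rintro k ⟨C, R, ⟨-, h⟩, rfl⟩
    simp at h; omega
  obtain ⟨C, R, ⟨hCR, hlen'⟩, hk⟩ := Nat.findGreatest_spec (P := fun k => ∃ C R,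
    (G.IsLollipop C R ∧ (C ++ R).length = l.length) ∧ C.length = k) (hb _ hex'.choose_spec)
    hex'.choose_spec
  refine ⟨C, R, ⟨hCR, fun l' h' => (hmax l' h').trans hlen'.ge, fun C' R' h' he => ?_⟩,
    hlen'.trans hlen⟩
  rw [hk]
  refine Nat.le_findGreatest ?_ ⟨C', R', ⟨h', he.trans hlen'⟩, rfl⟩
  have := he.trans hlen'
  simp at this; omega

/-- If no two consecutive entries satisfy `Q` and `P` respectively, the two counts add up to at most
the length. -/
theorem _root_.List.countP_add_countP_tail_le {α : Type*} (P Q : α → Bool) :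
    ∀ l : List α, (∀ a u w b, l = a ++ u :: w :: b → ¬(Q u = true ∧ P w = true)) →
      l.countP Q + l.tail.countP P ≤ l.length
  | [], _ => by simp
  | [u], _ => by simpa using List.countP_le_length (p := Q) (l := [u])
  | u :: w :: b, h => by
    have ih := List.countP_add_countP_tail_le P Q (w :: b) fun a u' w' b' he =>
      h (u :: a) u' w' b' (by simp [he])
    have h0 := h [] u w b rfl
    simp only [List.tail_cons, List.length_cons] at ih ⊢
    rw [List.countP_cons (l := w :: b), List.countP_cons (a := w) (p := P)]
    cases hu : Q u <;> cases hw : P w <;> simp_all <;> omega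

theorem degree_le_countP [Fintype V] [DecidableRel G.Adj] {x : V} {l : List V}
    (h : ∀ y, G.Adj x y → y ∈ l) : G.degree x ≤ l.countP (fun y => decide (G.Adj x y)) := by
  classical
  rw [← card_neighborFinset_eq_degree, List.countP_eq_length_filter]
  refine (Finset.card_le_card fun y hy => ?_).trans (List.toFinset_card_le _)
  rw [mem_neighborFinset] at hy
  simp [hy, h y hy]

/-- Ore's argument: two disjoint paths whose first vertices have large degree can be merged into a
path joining their last vertices. -/
theorem exists_isChain_perm_of_le_degree_add [Fintype V] [DecidableRel G.Adj] {x y : V}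
    {S₁ S₂ : List V} (h₁ : (x :: S₁).IsChain G.Adj) (h₂ : (y :: S₂).IsChain G.Adj)
    (hx : ∀ z, G.Adj x z → z ∈ x :: S₁ ++ y :: S₂) (hy : ∀ z, G.Adj y z → z ∈ x :: S₁ ++ y :: S₂)
    (hdeg : (x :: S₁ ++ y :: S₂).length < G.degree x + G.degree y) :
    ∃ L : List V, L.Perm (x :: S₁ ++ y :: S₂) ∧ L.IsChain G.Adj ∧ L.head? = (x :: S₁).getLast? ∧
      L.getLast? = (y :: S₂).getLast? := by
  by_contra! hcon
  -- For consecutive `u, w` in the first path with `y ~ u` and `x ~ w`, go from its end back to `w`,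
  -- jump to `x`, run to `u`, jump to `y` and finish along the second path.
  have c₁ := List.countP_add_countP_tail_le (fun w => decide (G.Adj x w))
    (fun u => decide (G.Adj y u)) (x :: S₁) fun a u w b he hqp => by
      simp only [decide_eq_true_eq] at hqp
      refine hcon ((w :: b).reverse ++ ((a ++ [u]) ++ y :: S₂)) ?_ ?_ ?_ ?_
      · rw [he, ← List.append_assoc]
        refine List.Perm.append_right _ ?_
        refine (List.perm_append_comm).trans ?_
        have := (List.reverse_perm (w :: b)).append_left (a ++ [u])
        simpa using this
      · rw [he] at h₁
        rw [List.isChain_append, isChain_adj_reverse, List.isChain_append]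
        refine ⟨h₁.of_isInfix ⟨a ++ [u], [], by simp⟩, ⟨h₁.of_isInfix ⟨[], w :: b, by simp⟩, h₂, ?_⟩, ?_⟩
        · simpa using hqp.1.symm
        · have : (a ++ [u]).head? = some x := by
            have := congrArg List.head? he
            cases a <;> simp_all
          rw [List.head?_append, this]
          simpa using hqp.2.symm
      · rw [he]; simp [List.getLast?_append, List.getLast?_cons]
      · rw [← List.append_assoc, List.getLast?_append_cons]
  -- For consecutive `u, w` in the second path with `x ~ u` and `y ~ w`, run back to `x`, jump to
  -- `u`, run back to `y`, jump to `w` and finish.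
  have c₂ := List.countP_add_countP_tail_le (fun w => decide (G.Adj y w))
    (fun u => decide (G.Adj x u)) (y :: S₂) fun a u w b he hqp => by
      simp only [decide_eq_true_eq] at hqp
      refine hcon ((x :: S₁).reverse ++ ((a ++ [u]).reverse ++ w :: b)) ?_ ?_ ?_ ?_
      · rw [he]
        refine (List.reverse_perm _).append ?_
        have := (List.reverse_perm (a ++ [u])).append_right (w :: b)
        simpa using this
      · rw [he] at h₂
        rw [List.isChain_append, isChain_adj_reverse, List.isChain_append, isChain_adj_reverse]
        refine ⟨h₁, ⟨h₂.of_isInfix ⟨[], w :: b, by simp⟩, h₂.of_isInfix ⟨a ++ [u], [], by simp⟩, ?_⟩, ?_⟩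
        · have : (a ++ [u]).head? = some y := by
            have := congrArg List.head? he
            cases a <;> simp_all
          rw [List.getLast?_reverse, this]
          simpa using hqp.2
        · simpa using hqp.1
      · simp [List.getLast?_cons]
      · rw [he, ← List.append_assoc, List.getLast?_append_cons, List.getLast?_append_cons,
          List.getLast?_cons_cons]
  have d₁ := degree_le_countP hx
  have d₂ := degree_le_countP hy
  rw [List.countP_append] at d₁ d₂
  simp at c₁ c₂ d₁ d₂ hdeg
  omega

/-- The rearranged path is still longest, so `z` lies on it; if `z` were in `R`, the edge `e z`
would close a cycle longer than `C`. -/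
theorem IsMaxLollipop.mem_of_adj {C R C' : List V} (h : G.IsMaxLollipop C R) (hC : C'.Perm C)
    (hc : (C' ++ R).IsChain G.Adj) {e z : V} (he : C'.head? = some e) (hz : G.Adj e z) :
    z ∈ C := by
  have hlen : C'.length = C.length := hC.length_eq
  have hp : G.IsPathList (C' ++ R) := ⟨hc, ((hC.append_right R).nodup_iff).2 h.path.2⟩
  have h3 := h.cycle.1
  obtain ⟨C'', rfl⟩ : ∃ C'', C' = e :: C'' := by
    cases C' <;> simp_all
  have hm : z ∈ C'' ++ R := hp.mem_of_adj_head
    (fun l hl => (h.length_le l hl).trans (by simp at hlen ⊢; omega)) hz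
  rcases List.mem_append.1 hm with hm | hm
  · exact hC.subset (by simp [hm])
  · exfalso
    obtain ⟨R₁, R₂, rfl⟩ := List.append_of_mem hm
    have := h.cycle_length_le (e :: C'' ++ R₁ ++ [z]) R₂ ⟨by simpa using hp, by
      rw [isCycleList_iff]
      refine ⟨by simp at hlen ⊢; omega, ⟨hp.1.of_isInfix ⟨[], R₂, by simp⟩, hp.2.sublist
        (List.IsInfix.sublist ⟨[], R₂, by simp⟩)⟩, ?_⟩
      rw [List.append_assoc, List.cons_append, ← List.append_assoc, List.getLast?_cons_concat]
      simpa using hz.symm⟩ (by simp at hlen ⊢; omega)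
    simp at this hlen
    omega

theorem IsMaxLollipop.two_mul_le_length [Fintype V] [DecidableRel G.Adj]
    (hG : G.IsVertexConnected 2) {δ : ℕ} (hδ : ∀ v, δ ≤ G.degree v) {C R : List V}
    (h : G.IsMaxLollipop C R) (hR : R ≠ []) : 2 * δ ≤ C.length := by
  by_contra! hlt
  have h3 := h.cycle.1
  obtain ⟨c, C₀, rfl⟩ : ∃ c C₀, C = c :: C₀ := by cases C <;> simp_all
  obtain ⟨C₁, a, hC₁⟩ := List.eq_nil_or_concat' C₀ |>.resolve_left (by rintro rfl; simp at h3)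
  subst hC₁
  obtain ⟨-, hpath, hclose⟩ := isCycleList_iff.1 h.cycle
  have hac : G.Adj a c := by
    rw [List.getLast?_cons_concat] at hclose; simpa using hclose
  have haR : ∀ y ∈ R.head?, G.Adj a y := by
    simpa [List.getLast?_cons] using (List.isChain_append.1 h.path.1).2.2
  have hRc := (List.isChain_append.1 h.path.1).2.1
  -- every vertex of the cycle but `a` starts a longest path ending with `R`
  have key : ∀ S₂ S₁ : List V, c :: (C₁ ++ [a]) = S₁ ++ S₂ → S₁ ≠ [] → S₂ ≠ [] →
      ∃ C', C'.Perm (c :: (C₁ ++ [a])) ∧ (C' ++ R).IsChain G.Adj ∧ C'.head? = S₁.getLast? := by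
    -- Work backwards from `a`. The longest path starting at `y`, given by induction, confines the
    -- neighbours of `y` to the cycle, so the Ore merge applies to the pieces starting at `c` and
    -- `y`.
    intro S₂
    induction S₂ with
    | nil => simp
    | cons y S₂ ih =>
      intro S₁ hS hS₁ _
      rcases eq_or_ne S₂ [] with rfl | hS₂
      · have hS' : c :: C₁ = S₁ ∧ a = y := by
          have : (c :: C₁) ++ [a] = S₁ ++ [y] := by simpa using hS
          simpa using List.append_inj' this rfl
        obtain ⟨rfl, rfl⟩ := hS'
        refine ⟨(c :: C₁).reverse ++ [a], ?_, ?_, ?_⟩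
        · have := (List.reverse_perm (c :: C₁)).append_right [a]
          simpa using this
        · rw [List.append_assoc, List.isChain_append, isChain_adj_reverse]
          refine ⟨hpath.1.of_isInfix ⟨[], [a], by simp⟩, ?_, ?_⟩
          · rw [List.singleton_append, List.isChain_cons]
            exact ⟨haR, hRc⟩
          · simpa using hac.symm
        · simp [List.getLast?_cons]
      · obtain ⟨C', hC', hc', he⟩ := ih (S₁ ++ [y]) (by simpa using hS) (by simp) hS₂
        obtain ⟨S₁', rfl⟩ : ∃ S₁', S₁ = c :: S₁' := by
          cases S₁ <;> simp_all
        rw [hS] at hpath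
        obtain ⟨L, hL, hLc, hLh, hLl⟩ := exists_isChain_perm_of_le_degree_add (G := G)
          (hpath.1.of_isInfix ⟨[], y :: S₂, by simp⟩) (hpath.1.of_isInfix ⟨c :: S₁', [], by simp⟩)
          (fun z hz => hS ▸ h.mem_of_adj (List.Perm.refl _) h.path.1 (by simp) hz)
          (fun z hz => hS ▸ h.mem_of_adj hC' hc' (by
            rw [he, List.cons_append, List.getLast?_cons_concat]) hz)
          (by have := hδ c; have := hδ y; rw [← hS]; omega)
        refine ⟨L, hS ▸ hL, ?_, hLh⟩
        rw [List.isChain_append]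
        refine ⟨hLc, hRc, ?_⟩
        have : (y :: S₂).getLast? = some a := by
          have := congrArg List.getLast? hS
          simpa [List.getLast?_cons, List.getLast?_append] using this.symm
        rw [hLl, this]
        simpa using haR
  have hall : ∀ e ∈ c :: C₁, ∀ z, G.Adj e z → z ∈ c :: (C₁ ++ [a]) := by
    intro e he z hz
    obtain ⟨l₁, l₂, hl⟩ := List.append_of_mem he
    obtain ⟨C', hC', hc', hh⟩ := key (l₂ ++ [a]) (l₁ ++ [e]) (by
      have := congrArg (· ++ [a]) hl
      simpa using this) (by simp) (by simp)
    exact h.mem_of_adj hC' hc' (by simpa using hh) hz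
  obtain ⟨y, R', rfl⟩ : ∃ y R', R = y :: R' := by cases R <;> simp_all
  have hnd := h.path.2
  have hac' := hac.ne
  simp [List.nodup_append] at hnd
  -- Otherwise `a` would separate the rest of the cycle from `R`.
  obtain ⟨u, hu, v, hv, hua, hva, huv⟩ := hG.exists_adj a {z | z ∈ c :: (C₁ ++ [a])} (x := c)
    (y := y) (by simp) hac'.symm (by simp; grind) (by grind)
  exact hv (hall u (by simp at hu ⊢; grind) v huv)

end SimpleGraph

/-! ### Gaps between two sets of points on a cycle -/

section ZModGaps

open Finset

variable {K : ℕ} [NeZero K] {A B : Finset (ZMod K)} {r : ℕ}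

theorem ZMod.val_sub_natCast_lt {x : ZMod K} {d : ℕ} (hd : 1 ≤ d) (hx : d ≤ x.val) :
    (x - d).val < x.val := by
  have hK := ZMod.val_lt x
  have : ((x.val - d : ℕ) : ZMod K) = x - d := by
    rw [Nat.cast_sub hx, ZMod.natCast_zmod_val]
  rw [← this, ZMod.val_natCast, Nat.mod_eq_of_lt (by omega)]
  omega

theorem ZMod.lt_val_sub_of_ne {a b : ZMod K} (h : ∀ d : ℕ, 1 ≤ d → d ≤ r → a + d ≠ b)
    (hab : a ≠ b) : r < (b - a).val := by
  by_contra! hle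
  refine h _ (Nat.one_le_iff_ne_zero.2 fun h0 => hab ?_) hle (by
    rw [ZMod.natCast_zmod_val]; ring)
  rw [ZMod.val_eq_zero] at h0
  exact (sub_eq_zero.1 h0).symm

/-- Take distinct `a ∈ A`, `b ∈ B` with the least forward distance from `a` to `b`. A point of `A`
soon after `a` would be closer to `b`, and a point of `B` there is excluded by hypothesis. -/
theorem ZMod.exists_mem_forall_add_notMem (hAB : ∀ a ∈ A, ∀ b ∈ B, a ≠ b → ∀ d : ℕ, 1 ≤ d →
      d ≤ r → a + d ≠ b) (hne : ∃ a ∈ A, ∃ b ∈ B, a ≠ b) :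
    ∃ a ∈ A, ∀ d : ℕ, 1 ≤ d → d ≤ r → a + d ∉ A ∪ B := by
  have hne' : ((A ×ˢ B).filter fun x => x.1 ≠ x.2).Nonempty := by
    obtain ⟨a, ha, b, hb, hab⟩ := hne
    exact ⟨(a, b), by simp [ha, hb, hab]⟩
  obtain ⟨⟨a, b⟩, hmem, hmin⟩ := exists_min_image _ (fun x => (x.2 - x.1).val) hne'
  simp only [mem_filter, mem_product] at hmem
  obtain ⟨⟨ha, hb⟩, hab⟩ := hmem
  have hgap := ZMod.lt_val_sub_of_ne (hAB a ha b hb hab) hab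
  have hK := ZMod.val_lt (b - a)
  refine ⟨a, ha, fun d hd hdr hT => ?_⟩
  have hda : a ≠ a + d := fun h => by
    have h0 : (d : ZMod K) = 0 := by simpa using h
    rw [ZMod.natCast_eq_zero_iff] at h0
    have := Nat.le_of_dvd (by omega) h0
    omega
  rcases mem_union.1 hT with h | h
  · have := hmin (a + d, b) (by simp [h, hb, hAB a ha b hb hab d hd hdr])
    simp only [← sub_sub] at this
    have := ZMod.val_sub_natCast_lt (x := b - a) hd (by omega)
    omega
  · exact hAB a ha _ h hda d hd hdr rfl

/-- The sets `T`, `T + 1` and the translates `Bg + d`, `2 ≤ d ≤ r`, are pairwise disjoint: a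
collision would put a point of `T` inside one of the long gaps. -/
theorem ZMod.two_mul_card_add_le {T Bg : Finset (ZMod K)} (hT : ∀ τ ∈ T, τ + 1 ∉ T)
    (hBT : Bg ⊆ T) (hBg : ∀ τ ∈ Bg, ∀ d : ℕ, 1 ≤ d → d ≤ r → τ + d ∉ T) :
    2 * #T + (r - 1) * #Bg ≤ K := by
  have hinj : Set.InjOn (fun x : ZMod K × ℕ => x.1 + (x.2 : ZMod K)) (Bg ×ˢ Icc 2 r : Finset _) := by
    have key : ∀ b b' : ZMod K, ∀ d d' : ℕ, b ∈ Bg → b' ∈ Bg → 2 ≤ d → d' ≤ r → d < d' →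
        b + d ≠ b' + d' := by
      intro b b' d d' hb hb' hd hd' hlt he
      refine hBg b' hb' (d' - d) (by omega) (by omega) ?_
      convert hBT hb
      rw [Nat.cast_sub hlt.le, ← sub_eq_iff_eq_add.2 he.symm]
      ring_nf
    rintro ⟨b, d⟩ h ⟨b', d'⟩ h' he
    simp only [coe_product, Set.mem_prod, mem_coe, mem_Icc] at h h' he
    rcases lt_trichotomy d d' with hlt | rfl | hlt
    · exact (key b b' d d' h.1 h'.1 h.2.1 h'.2.2 hlt he).elim
    · simpa using he
    · exact (key b' b d' d h'.1 h.1 h'.2.1 h.2.2 hlt he.symm).elim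
  have h₁ : #(T.image (· + 1)) = #T := card_image_of_injective _ (add_left_injective 1)
  have h₂ : #((Bg ×ˢ Icc 2 r).image fun x => x.1 + (x.2 : ZMod K)) = #Bg * (r - 1) := by
    rw [card_image_of_injOn hinj, card_product, Nat.card_Icc]
    congr 1
  have d₁ : Disjoint T (T.image (· + 1)) := by
    rw [disjoint_right]
    intro x hx
    obtain ⟨τ, hτ, rfl⟩ := mem_image.1 hx
    exact hT τ hτ
  have d₂ : Disjoint (T ∪ T.image (· + 1)) ((Bg ×ˢ Icc 2 r).image fun x => x.1 + (x.2 : ZMod K)) := by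
    rw [disjoint_right]
    intro x hx hx'
    obtain ⟨⟨b, d⟩, hbd, rfl⟩ := mem_image.1 hx
    simp only [mem_product, mem_Icc] at hbd
    rcases mem_union.1 hx' with h | h
    · exact hBg b hbd.1 d (by omega) hbd.2.2 h
    · obtain ⟨τ, hτ, he⟩ := mem_image.1 h
      refine hBg b hbd.1 (d - 1) (by omega) (by omega) ?_
      convert hτ
      simp only at he
      rw [Nat.cast_sub (by omega), Nat.cast_one, eq_sub_iff_add_eq.2 he]
      ring
  have := card_le_univ ((T ∪ T.image (· + 1)) ∪ (Bg ×ˢ Icc 2 r).image fun x => x.1 + (x.2 : ZMod K))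
  rw [card_union_of_disjoint d₂, card_union_of_disjoint d₁, h₁, h₂, ZMod.card] at this
  rw [mul_comm (r - 1)]
  omega

/-- Two sets of points on a cycle, neither of which contains neighbouring points, such that distinct
points of different sets are at distance more than `r`, need a long cycle. -/
theorem ZMod.le_of_gaps {s : ℕ} (hr : 2 ≤ r) (hs : 2 ≤ s) (hA : s ≤ #A) (hB : s ≤ #B)
    (hA' : ∀ a ∈ A, a + 1 ∉ A) (hB' : ∀ b ∈ B, b + 1 ∉ B)
    (hAB : ∀ a ∈ A, ∀ b ∈ B, a ≠ b → ∀ d : ℕ, 1 ≤ d → d ≤ r → a + d ≠ b)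
    (hBA : ∀ b ∈ B, ∀ a ∈ A, b ≠ a → ∀ d : ℕ, 1 ≤ d → d ≤ r → b + d ≠ a) :
    3 * s + 2 * r ≤ K + 4 := by
  obtain ⟨b₀, hb₀⟩ : B.Nonempty := card_pos.1 (by omega)
  obtain ⟨a₀, ha₀, hab₀⟩ : ∃ a ∈ A, a ≠ b₀ := exists_mem_ne (by omega) b₀
  have hrK : r < K := (ZMod.lt_val_sub_of_ne (hAB a₀ ha₀ b₀ hb₀ hab₀) hab₀).trans (ZMod.val_lt _)
  have hself : ∀ (τ : ZMod K) (d : ℕ), 1 ≤ d → d ≤ r → τ ≠ τ + d := fun τ d hd hdr h => by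
    have h0 : (d : ZMod K) = 0 := by simpa using h
    rw [ZMod.natCast_eq_zero_iff] at h0
    have := Nat.le_of_dvd (by omega) h0
    omega
  set T := A ∪ B with hTdef
  set Bg := T.filter fun τ => ∀ d : ℕ, 1 ≤ d → d ≤ r → τ + (d : ZMod K) ∉ T with hBgdef
  have hT : ∀ τ ∈ T, τ + 1 ∉ T := by
    intro τ hτ hτ'
    have hne : τ ≠ τ + 1 := by simpa using hself τ 1 le_rfl (by omega)
    rcases mem_union.1 hτ with h | h <;> rcases mem_union.1 hτ' with h' | h'
    · exact hA' _ h h'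
    · exact hAB τ h _ h' hne 1 le_rfl (by omega) (by simp)
    · exact hBA τ h _ h' hne 1 le_rfl (by omega) (by simp)
    · exact hB' _ h h'
  -- A common point is far from every other point of either set.
  have hq : A ∩ B ⊆ Bg := by
    intro τ hτ
    rw [mem_inter] at hτ
    refine mem_filter.2 ⟨mem_union_left _ hτ.1, fun d hd hdr h => ?_⟩
    rcases mem_union.1 h with h | h
    · exact hBA τ hτ.2 _ h (hself τ d hd hdr) d hd hdr rfl
    · exact hAB τ hτ.1 _ h (hself τ d hd hdr) d hd hdr rfl
  have hg : 2 ≤ #Bg := by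
    obtain ⟨a, ha, ha'⟩ := ZMod.exists_mem_forall_add_notMem hAB ⟨a₀, ha₀, b₀, hb₀, hab₀⟩
    obtain ⟨b, hb, hb'⟩ := ZMod.exists_mem_forall_add_notMem hBA ⟨b₀, hb₀, a₀, ha₀, hab₀.symm⟩
    have haBg : a ∈ Bg := mem_filter.2 ⟨mem_union_left _ ha, ha'⟩
    have hbBg : b ∈ Bg := mem_filter.2 ⟨mem_union_right _ hb, by rwa [union_comm] at hb'⟩
    rcases eq_or_ne a b with rfl | hab
    -- Here `a` lies in both sets, so the point of `T` nearest before `a` is also more than `r` away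
    -- and starts a second long gap.
    · have hne : (T.erase a).Nonempty := by
        obtain ⟨x, hx, hxa⟩ := exists_mem_ne (by omega : 1 < #A) a
        exact ⟨x, mem_erase.2 ⟨hxa, mem_union_left _ hx⟩⟩
      obtain ⟨τ, hτ, hmin⟩ := exists_min_image _ (fun x => (a - x).val) hne
      rw [mem_erase] at hτ
      have hsep : ∀ d : ℕ, 1 ≤ d → d ≤ r → τ + d ≠ a := by
        rcases mem_union.1 hτ.2 with h | h
        · exact hAB τ h a hb hτ.1
        · exact hBA τ h a ha hτ.1
      have hgap := ZMod.lt_val_sub_of_ne hsep hτ.1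
      have hτBg : τ ∈ Bg := mem_filter.2 ⟨hτ.2, fun d hd hdr h => by
        have := hmin (τ + d) (mem_erase.2 ⟨hsep d hd hdr, h⟩)
        simp only [← sub_sub] at this
        have := ZMod.val_sub_natCast_lt (x := a - τ) hd (by omega)
        omega⟩
      exact one_lt_card.2 ⟨τ, hτBg, a, haBg, hτ.1⟩
    · exact one_lt_card.2 ⟨a, haBg, b, hbBg, hab⟩
  have hmain := ZMod.two_mul_card_add_le (r := r) hT (filter_subset _ _)
    (fun τ hτ => (mem_filter.1 hτ).2)
  have hcard := card_union_add_card_inter A B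
  have hq' := card_le_card hq
  have hqA := card_le_card (inter_subset_left : A ∩ B ⊆ A)
  have hqB := card_le_card (inter_subset_right : A ∩ B ⊆ B)
  rw [← hTdef] at hcard
  rw [← hBgdef] at hmain
  obtain ⟨r', rfl⟩ := Nat.exists_eq_add_of_le hr
  -- With `q = #(A ∩ B)` and `g = #Bg ≥ max 2 q`, the count is `2#A + 2#B - 2q + g + (r - 2)g`, at
  -- least `3s + 2(r - 2)` because `q ≤ g` and `q ≤ #A`.
  have : r' * 2 ≤ r' * #Bg := Nat.mul_le_mul_left _ hg
  have h1 : (2 + r' - 1) * #Bg = #Bg + r' * #Bg := by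
    rw [show 2 + r' - 1 = 1 + r' by omega]; ring
  omega

end ZModGaps

/-! ### Tails with at least two vertices and the bound `3δ` -/

theorem List.exists_eq_getElem_zero_cons {α : Type*} (l : List α) {d : ℕ} (hd : 0 < d)
    (hdl : d < l.length) :
    ∃ mid rest, l = l[0] :: (mid ++ l[d] :: rest) ∧ mid.length + 1 = d := by
  refine ⟨(l.drop 1).take (d - 1), l.drop (d + 1), ?_, by simp; omega⟩
  rw [← List.drop_eq_getElem_cons hdl]
  have h1 : l = l[0] :: l.drop 1 := by
    rw [← List.drop_eq_getElem_cons (by omega)]; simp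
  conv_lhs => rw [h1, ← List.take_append_drop (d - 1) (l.drop 1), List.drop_drop]
  rw [show 1 + (d - 1) = d by omega]

namespace SimpleGraph

variable {V : Type*} {G : SimpleGraph V}

theorem IsCycleList.rotate {l : List V} (h : G.IsCycleList l) (n : ℕ) :
    G.IsCycleList (l.rotate n) := by
  rw [List.rotate_eq_drop_append_take_mod]
  exact IsCycleList.append_comm (by rwa [List.take_append_drop])

theorem IsMaxLollipop.of_perm {C R C' R' : List V} (h : G.IsMaxLollipop C R)
    (hC' : G.IsCycleList C') (hC : C'.Perm C) (hR : R'.Perm R) (hc : (C' ++ R').IsChain G.Adj) :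
    G.IsMaxLollipop C' R' := by
  have hperm := hC.append hR
  refine ⟨⟨⟨hc, hperm.nodup_iff.2 h.path.2⟩, hC'⟩, ?_, ?_⟩
  · rw [hperm.length_eq]; exact h.length_le
  · rw [hperm.length_eq, hC.length_eq]; exact h.cycle_length_le

/-- Otherwise `u` could be inserted between `t` and `t'`, enlarging the cycle. -/
theorem IsMaxLollipop.not_adj_of_adj {C R rest : List V} {t t' u : V}
    (h : G.IsMaxLollipop C (u :: R)) (hcyc : G.IsCycleList (t :: t' :: rest))
    (hperm : (t :: t' :: rest).Perm C) (ht : G.Adj u t) : ¬G.Adj u t' := by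
  intro ht'
  have hrot : G.IsCycleList ((t' :: rest) ++ [t]) := IsCycleList.append_comm (a := [t]) hcyc
  have hR := (List.isChain_append.1 h.path.1).2.1
  have hchain : ((t' :: rest ++ [t]) ++ u :: R).IsChain G.Adj := by
    rw [List.isChain_append]
    exact ⟨hrot.isPathList.1, hR, by simpa [List.getLast?_cons] using ht.symm⟩
  have hp : G.IsPathList ((t' :: rest ++ [t]) ++ u :: R) := ⟨hchain, by
    rw [List.Perm.nodup_iff (List.Perm.append_right _
      ((List.perm_append_comm (l₁ := t' :: rest) (l₂ := [t])).trans hperm))]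
    exact h.path.2⟩
  have hlen := hperm.length_eq
  have := h.cycle_length_le (t' :: rest ++ [t] ++ [u]) R ⟨by simpa using hp, by
    rw [isCycleList_iff]
    refine ⟨by simp, ⟨hp.1.of_isInfix ⟨[], R, by simp⟩, hp.2.sublist
      (List.IsInfix.sublist ⟨[], R, by simp⟩)⟩, ?_⟩
    simpa [List.getLast?_cons] using ht'⟩ (by simp at hlen ⊢; omega)
  simp at this hlen
  omega

/-- Replacing the arc `mid` by `ρ` gives another lollipop on the same vertices, with `mid` reversed
as its tail at `t'`; its cycle cannot be longer. -/
theorem IsMaxLollipop.length_le_of_adj {C R ρ mid rest : List V} {t t' : V}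
    (h : G.IsMaxLollipop C R) (hcyc : G.IsCycleList (t :: (mid ++ t' :: rest)))
    (hperm : (t :: (mid ++ t' :: rest)).Perm C) (hρ : ρ.Perm R) (hρc : ρ.IsChain G.Adj)
    (hρ0 : ρ ≠ []) (ht : ∀ x ∈ ρ.head?, G.Adj t x) (ht' : ∀ x ∈ ρ.getLast?, G.Adj x t') :
    R.length ≤ mid.length := by
  have hrot : G.IsCycleList ((t' :: rest) ++ (t :: mid)) :=
    IsCycleList.append_comm (a := t :: mid) (by simpa using hcyc)
  have hback : (t' :: (rest ++ [t])).IsChain G.Adj :=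
    hrot.isPathList.1.of_isInfix ⟨[], mid, by simp⟩
  have hmid : (mid ++ [t']).IsChain G.Adj := hcyc.isPathList.1.of_isInfix ⟨[t], rest, by simp⟩
  have hmid' : (t' :: mid.reverse).IsChain G.Adj := by
    have := isChain_adj_reverse.2 hmid
    simpa using this
  rw [List.isChain_cons] at hback
  have hclosed : ((rest ++ [t]) ++ (ρ ++ t' :: mid.reverse)).IsChain G.Adj := by
    rw [List.isChain_append, List.isChain_append (l₁ := ρ)]
    refine ⟨hback.2, ⟨hρc, hmid', by simpa using ht'⟩, ?_⟩
    rw [List.head?_append_of_ne_nil _ hρ0]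
    simpa using ht
  have hP : ((rest ++ [t]) ++ (ρ ++ t' :: mid.reverse)).Perm (C ++ R) := by
    refine List.Perm.trans ?_ (hperm.append hρ)
    rw [← Multiset.coe_eq_coe]
    simp only [← Multiset.coe_add, ← Multiset.cons_coe, ← Multiset.singleton_add,
      Multiset.coe_reverse, Multiset.coe_nil]
    abel_nf
  have hlen := hP.length_eq
  have hlR := hρ.length_eq
  have hlC := hperm.length_eq
  have hρpos := List.length_pos_iff.2 hρ0
  have := h.cycle_length_le ((rest ++ [t]) ++ (ρ ++ [t'])) mid.reverse
    ⟨⟨by simpa using hclosed, by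
      have := hP.nodup_iff.2 h.path.2
      simpa using this⟩, by
      rw [isCycleList_iff]
      refine ⟨by simp; omega, ⟨hclosed.of_isInfix ⟨[], mid.reverse, by simp⟩,
        (hP.nodup_iff.2 h.path.2).sublist (List.IsInfix.sublist ⟨[], mid.reverse, by simp⟩)⟩, ?_⟩
      rw [← List.append_assoc, List.getLast?_concat]
      intro x hx y hy
      obtain rfl : t' = x := by simpa using hx
      refine hback.1 y ?_
      rw [List.append_assoc, List.head?_append_of_ne_nil _ (by simp)] at hy
      exact hy⟩
    (by simpa using hlen)
  simp at this hlen hlC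
  omega

theorem IsMaxLollipop.three_mul_le [Fintype V] [DecidableRel G.Adj]
    (hG : G.IsVertexConnected 2) {δ : ℕ} (hδ : ∀ v, δ ≤ G.degree v) {C R : List V}
    (h : G.IsMaxLollipop C R) (hR : 2 ≤ R.length) : 3 * δ ≤ (C ++ R).length + 1 := by
  classical
  have hK := h.two_mul_le_length hG hδ (by rintro rfl; simp at hR)
  rw [List.length_append]
  by_contra! hlt
  have hrδ : R.length + 1 ≤ δ := by omega
  have h3 := h.cycle.1
  set K := C.length with hKdef
  have : NeZero K := ⟨by omega⟩
  obtain ⟨u, R₁, hu⟩ : ∃ u R₁, R = u :: R₁ := by cases R <;> simp_all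
  obtain ⟨R₂, w, hw⟩ := (List.eq_nil_or_concat' R).resolve_left (by rintro rfl; simp at hR)
  let f : ZMod K → V := fun τ => C[τ.val]'(ZMod.val_lt τ)
  have hf_surj : ∀ z ∈ C, ∃ τ, f τ = z := by
    intro z hz
    obtain ⟨i, hi, rfl⟩ := List.mem_iff_getElem.1 hz
    exact ⟨(i : ZMod K), by simp [f, ZMod.val_natCast, Nat.mod_eq_of_lt (hKdef ▸ hi)]⟩
  have hdecomp : ∀ (τ : ZMod K) (d : ℕ), 0 < d → d < K → ∃ mid rest,
      C.rotate τ.val = f τ :: (mid ++ f (τ + d) :: rest) ∧ mid.length + 1 = d := by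
    intro τ d hd hdK
    obtain ⟨mid, rest, he, hl⟩ := (C.rotate τ.val).exists_eq_getElem_zero_cons hd
      (by simpa using hdK)
    refine ⟨mid, rest, ?_, hl⟩
    have e0 : (C.rotate τ.val)[0]'(by simp; omega) = f τ := by
      simp only [f, List.getElem_rotate]
      congr 1
      rw [zero_add]
      exact Nat.mod_eq_of_lt (ZMod.val_lt τ)
    have ed : (C.rotate τ.val)[d]'(by simpa using hdK) = f (τ + d) := by
      simp only [f, List.getElem_rotate]
      congr 1
      rw [ZMod.val_add, ZMod.val_natCast, Nat.add_mod_mod, add_comm]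
    rw [← e0, ← ed]
    exact he
  have hRc : R.IsChain G.Adj := (List.isChain_append.1 h.path.1).2.1
  have hRn : R.Nodup := (List.nodup_append.1 h.path.2).2.1
  let N : V → Finset (ZMod K) := fun x => Finset.univ.filter fun τ => G.Adj x (f τ)
  have hdeg : ∀ x ∈ R, (∀ z, G.Adj x z → z ∈ C ++ R) → δ + 1 ≤ (N x).card + R.length := by
    intro x hx hxz
    have hsub : G.neighborFinset x ⊆ (N x).image f ∪ R.toFinset.erase x := by
      intro z hz
      rw [mem_neighborFinset] at hz
      rcases List.mem_append.1 (hxz z hz) with hm | hm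
      · obtain ⟨τ, rfl⟩ := hf_surj z hm
        exact Finset.mem_union_left _ (Finset.mem_image_of_mem f (by simpa [N] using hz))
      · exact Finset.mem_union_right _ (Finset.mem_erase.2 ⟨hz.ne', by simpa using hm⟩)
    have h1 := Finset.card_le_card hsub
    have h2 := Finset.card_union_le ((N x).image f) (R.toFinset.erase x)
    have h3 := Finset.card_image_le (s := N x) (f := f)
    rw [Finset.card_erase_of_mem (by simpa using hx), List.toFinset_card_of_nodup hRn] at h2
    rw [card_neighborFinset_eq_degree] at h1
    have := hδ x
    omega
  -- neighbours of the far end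
  have hlast : ∀ {C' R' : List V} {x : V}, G.IsMaxLollipop C' (R' ++ [x]) → ∀ z, G.Adj x z →
      z ∈ C' ++ (R' ++ [x]) := by
    intro C' R' x h' z hz
    have hrev : G.IsPathList (x :: (C' ++ R').reverse) := by
      have := h'.path.reverse
      simpa using this
    have := hrev.mem_of_adj_head (fun l hl => (h'.length_le l hl).trans (by simp; omega)) hz
    simp at this ⊢
    tauto
  have hBcard := hdeg w (by simp [hw]) (hw ▸ hlast (hw ▸ h))
  obtain ⟨β, hβ⟩ : (N w).Nonempty := Finset.card_pos.1 (by omega)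
  have hβ' : G.Adj w (f β) := by simpa [N] using hβ
  -- Turning the cycle so that it ends at a neighbour of `w` lets the tail be attached in reverse.
  -- This makes the two ends of `R` interchangeable.
  have hrev : G.IsMaxLollipop (C.rotate (β.val + 1)) R.reverse := by
    refine h.of_perm (h.cycle.rotate _) (List.rotate_perm _ _) (List.reverse_perm _) ?_
    rw [List.isChain_append, isChain_adj_reverse]
    refine ⟨(h.cycle.rotate _).isPathList.1, hRc, ?_⟩
    have hβK := ZMod.val_lt β
    have h0 : C.rotate β.val ≠ [] := by
      intro h0
      have := congrArg List.length h0
      rw [List.length_rotate, List.length_nil] at this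
      omega
    have hl : (C.rotate (β.val + 1)).getLast? = some (f β) := by
      rw [← List.rotate_rotate, List.rotate_eq_drop_append_take (by simp; omega),
        List.getLast?_append]
      have : (C.rotate β.val).take 1 = [f β] := by
        rw [List.take_one, List.head?_eq_getElem?, List.getElem?_eq_getElem (by simp; omega),
          List.getElem_rotate]
        simp only [f, Option.toList_some, List.cons.injEq, and_true]
        congr 1
        rw [zero_add]
        exact Nat.mod_eq_of_lt hβK
      rw [this]
      simp
    rw [hl, hw]
    simpa using hβ'.symm
  have hrev' : G.IsMaxLollipop (C.rotate (β.val + 1)) (w :: R₂.reverse) := by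
    rw [hw] at hrev
    simpa using hrev
  have hAcard := hdeg u (by simp [hu]) (fun z hz => by
    have := hlast (R' := R₁.reverse) (x := u) (by rw [hu] at hrev; simpa using hrev) z hz
    simp [hu] at this ⊢
    tauto)
  have hone : ∀ {C' R' : List V} {x : V}, G.IsMaxLollipop C' (x :: R') → C'.Perm C →
      ∀ τ ∈ N x, τ + 1 ∉ N x := by
    intro C' R' x h' hC' τ hτ hτ'
    simp only [N, Finset.mem_filter, Finset.mem_univ, true_and] at hτ hτ'
    obtain ⟨mid, rest, he, hl⟩ := hdecomp τ 1 one_pos (by omega)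
    obtain rfl : mid = [] := List.length_eq_zero_iff.1 (by omega)
    rw [Nat.cast_one, List.nil_append] at he
    refine h'.not_adj_of_adj (he ▸ h.cycle.rotate _) ?_ hτ hτ'
    rw [← he]
    exact (List.rotate_perm _ _).trans hC'.symm
  have htwo : ∀ ρ : List V, ρ.Perm R → ρ.IsChain G.Adj → ∀ x y, ρ.head? = some x →
      ρ.getLast? = some y → ∀ τ ∈ N x, ∀ τ' ∈ N y, τ ≠ τ' → ∀ d : ℕ, 1 ≤ d → d ≤ R.length →
      τ + d ≠ τ' := by
    rintro ρ hρ hρc x y hx hy τ hτ τ' hτ' hne d hd hdR rfl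
    have hmod : ((d % K : ℕ) : ZMod K) = d := ZMod.natCast_mod d K
    have hdK : d % K < K := Nat.mod_lt _ (by omega)
    have hd0 : 0 < d % K := by
      rw [Nat.pos_iff_ne_zero]
      intro h0
      rw [h0] at hmod
      exact hne (by rw [← hmod]; simp)
    obtain ⟨mid, rest, he, hl⟩ := hdecomp τ (d % K) hd0 hdK
    rw [hmod] at he
    simp only [N, Finset.mem_filter, Finset.mem_univ, true_and] at hτ hτ'
    have := h.length_le_of_adj (he ▸ h.cycle.rotate _) (he ▸ List.rotate_perm _ _) hρ hρc
      (by rintro rfl; simp at hx) (by rw [hx]; simpa using hτ.symm) (by rw [hy]; simpa using hτ')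
    have := Nat.mod_le d K
    omega
  have hRh : R.head? = some u := by simp [hu]
  have hRl : R.getLast? = some w := by simp [hw]
  -- An end of `R` has at most `|R| - 1` neighbours in `R`, hence at least `s = δ + 1 - |R|` on the
  -- cycle. The result `3s + 2|R| ≤ K + 4` reads `3δ ≤ K + |R| + 1`.
  have := ZMod.le_of_gaps (A := N u) (B := N w) (r := R.length) (s := δ + 1 - R.length) hR
    (by omega) (by omega) (by omega)
    (hone (C' := C) (R' := R₁) (hu ▸ h) (List.Perm.refl _)) (hone hrev' (List.rotate_perm _ _))
    (htwo R (List.Perm.refl _) hRc u w hRh hRl)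
    (htwo R.reverse (List.reverse_perm _) (isChain_adj_reverse.2 hRc) w u (by simpa using hRl)
      (by simpa using hRh))
  omega

end SimpleGraph

/-! ### Vines and the cycles they carry -/

namespace SimpleGraph

variable {V : Type*} {G : SimpleGraph V} {v : ℕ → V} {n : ℕ}

/-- The part of the path `v 0, v 1, …` after index `a` and up to index `b`. -/
def pathSegment (v : ℕ → V) (a b : ℕ) : List V :=
  (List.range' (a + 1) (b - a)).map v

theorem mem_pathSegment {a b : ℕ} {z : V} :
    z ∈ pathSegment v a b ↔ ∃ k, a < k ∧ k ≤ b ∧ z = v k := by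
  simp only [pathSegment, List.mem_map, List.mem_range'_1]
  constructor
  · rintro ⟨k, hk, rfl⟩
    exact ⟨k, by omega, by omega, rfl⟩
  · rintro ⟨k, h₁, h₂, rfl⟩
    exact ⟨k, by omega, rfl⟩

@[simp] theorem length_pathSegment {a b : ℕ} : (pathSegment v a b).length = b - a := by
  simp [pathSegment]

theorem nodup_pathSegment (hv : Set.InjOn v (Set.Iic n)) {a b : ℕ} (hb : b ≤ n) :
    (pathSegment v a b).Nodup := by
  refine List.Nodup.map_on ?_ List.nodup_range'
  intro x hx y hy h
  rw [List.mem_range'_1] at hx hy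
  exact hv (by simp; omega) (by simp; omega) h

theorem isChain_append_pathSegment (hadj : ∀ i < n, G.Adj (v i) (v (i + 1))) {W : List V} {a b : ℕ}
    (hW : W.IsChain G.Adj) (hWa : W.getLast? = some (v a)) (hab : a ≤ b) (hb : b ≤ n) :
    (W ++ pathSegment v a b).IsChain G.Adj ∧
      (W ++ pathSegment v a b).getLast? = some (v b) := by
  obtain ⟨e, rfl⟩ := Nat.exists_eq_add_of_le hab
  clear hab
  induction e with
  | zero => simpa [pathSegment] using ⟨hW, hWa⟩
  | succ e ih =>
    obtain ⟨h₁, h₂⟩ := ih (by omega)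
    have hs : pathSegment v a (a + (e + 1)) = pathSegment v a (a + e) ++ [v (a + e + 1)] := by
      simp only [pathSegment, Nat.add_sub_cancel_left]
      rw [List.range'_1_concat]
      simp [Nat.add_right_comm a e 1, add_assoc]
    rw [hs, ← List.append_assoc]
    refine ⟨?_, by rw [List.getLast?_concat]; rfl⟩
    rw [List.isChain_append]
    refine ⟨h₁, by simp, ?_⟩
    rw [h₂]
    simpa using hadj (a + e) (by omega)

/-- A vine on the path `v 0, …, v n`: paths `v (X k), Q k, v (y (k + 1))` for `k < m`, disjoint from
each other and meeting the path in their ends only, such that consecutive ones interlace. The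
conventions `y 0 = 1` and `X m = n` make the conditions uniform. -/
structure IsVine (G : SimpleGraph V) (v : ℕ → V) (n m : ℕ) (X y : ℕ → ℕ) (Q : ℕ → List V) :
    Prop where
  inj : Set.InjOn v (Set.Iic n)
  adj : ∀ i < n, G.Adj (v i) (v (i + 1))
  y_zero : y 0 = 1
  X_zero : X 0 = 0
  y_last : y m = n
  X_last : X m = n
  X_lt : ∀ k < m, X k < y k
  le_X : ∀ k < m, y k ≤ X (k + 1)
  y_lt : ∀ k < m, y k < y (k + 1)
  chain : ∀ k < m, (v (X k) :: (Q k ++ [v (y (k + 1))])).IsChain G.Adj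
  off : ∀ k < m, ∀ z ∈ Q k, ∀ i ≤ n, z ≠ v i
  nodup : ∀ k < m, (Q k).Nodup
  disj : ∀ j k, j < k → k < m → (Q j).Disjoint (Q k)

/-- The total length of the first `k` segments of the path that are covered once by a vine. -/
def vineSum (X y : ℕ → ℕ) (k : ℕ) : ℕ :=
  ∑ l ∈ Finset.range k, (X (l + 1) - y l)

theorem vineSum_succ (X y : ℕ → ℕ) (k : ℕ) :
    vineSum X y (k + 1) = vineSum X y k + (X (k + 1) - y k) :=
  Finset.sum_range_succ _ _

theorem vineSum_mono (X y : ℕ → ℕ) : Monotone (vineSum X y) :=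
  monotone_nat_of_le_succ fun k => by rw [vineSum_succ]; omega

namespace IsVine

variable {m : ℕ} {X y : ℕ → ℕ} {Q : ℕ → List V}

theorem y_le (h : IsVine G v n m X y Q) {i j : ℕ} (hij : i ≤ j) (hj : j ≤ m) : y i ≤ y j := by
  induction j with
  | zero =>
    obtain rfl : i = 0 := by omega
    rfl
  | succ j ih =>
    rcases hij.lt_or_eq with hlt | rfl
    · exact (ih (by omega) (by omega)).trans (h.y_lt j (by omega)).le
    · rfl

theorem y_le_n (h : IsVine G v n m X y Q) {i : ℕ} (hi : i ≤ m) : y i ≤ n :=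
  h.y_last ▸ h.y_le hi le_rfl

theorem X_le_y (h : IsVine G v n m X y Q) {i : ℕ} (hi : i ≤ m) : X i ≤ y i := by
  rcases hi.lt_or_eq with hlt | rfl
  · exact (h.X_lt i hlt).le
  · rw [h.X_last, h.y_last]

/-- The cycle through the vine members `i, …, i + e`, without its segment between `v (y (i + e))`
and `v (y (i + e + 1))`. -/
theorem exists_isPathList (h : IsVine G v n m X y Q) (i : ℕ) : ∀ e, i + e < m →
    ∃ W, G.IsPathList W ∧ W.head? = some (v (y (i + e + 1))) ∧
      W.getLast? = some (v (y (i + e))) ∧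
      (∀ z ∈ W, (∃ k ≤ y (i + e), z = v k) ∨ z = v (y (i + e + 1)) ∨ ∃ k ≤ i + e, z ∈ Q k) ∧
      (y i - X i) + 2 + e + vineSum X y (i + e) ≤ W.length + vineSum X y i := by
  have hrev : ∀ k < m, (v (y (k + 1)) :: ((Q k).reverse ++ [v (X k)])).IsChain G.Adj := by
    intro k hk
    have := isChain_adj_reverse.2 (h.chain k hk)
    simpa using this
  intro e
  induction e with
  | zero =>
    intro hi
    rw [add_zero] at hi ⊢
    have hy := h.y_lt i hi
    have hyn := h.y_le_n (i := i + 1) hi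
    have hX := h.X_lt i hi
    have hsub := isChain_append_pathSegment h.adj (hrev i hi)
      (List.getLast?_cons_concat _ _ _) hX.le (hy.le.trans hyn)
    refine ⟨_, ⟨hsub.1, ?_⟩, by simp, hsub.2, ?_, ?_⟩
    rotate_right
    · simp
    · rw [List.nodup_append]
      refine ⟨?_, nodup_pathSegment h.inj (hy.le.trans hyn), ?_⟩
      · rw [List.nodup_cons, List.nodup_append]
        refine ⟨?_, List.nodup_reverse.2 (h.nodup i hi), by simp, ?_⟩
        · simp only [List.mem_append, List.mem_reverse, List.mem_singleton, not_or]
          refine ⟨fun hz => h.off i hi _ hz _ hyn rfl, fun he => ?_⟩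
          have := h.inj (by simpa using hyn) (by simp; omega) he
          omega
        · intro a ha b hb
          rw [List.mem_singleton] at hb
          exact hb ▸ h.off i hi a (by simpa using ha) _ (by omega)
      · intro a ha b hb
        obtain ⟨k, hk₁, hk₂, rfl⟩ := mem_pathSegment.1 hb
        simp only [List.mem_cons, List.mem_append, List.mem_reverse, List.not_mem_nil,
          or_false] at ha
        rcases ha with rfl | ha | rfl
        · intro he
          have := h.inj (by simpa using hyn) (by simp; omega) he
          omega
        · exact h.off i hi a ha k (by omega)
        · intro he
          have := h.inj (by simp; omega) (by simp; omega) he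
          omega
    · intro z hz
      simp only [List.mem_append, List.mem_cons, List.mem_reverse, List.not_mem_nil,
          or_false, mem_pathSegment] at hz
      rcases hz with (rfl | hz | rfl) | ⟨k, -, hk, rfl⟩
      · exact .inr (.inl rfl)
      · exact .inr (.inr ⟨i, le_rfl, hz⟩)
      · exact .inl ⟨_, hX.le, rfl⟩
      · exact .inl ⟨_, hk, rfl⟩
  | succ e ih =>
    intro hj
    obtain ⟨W, hW, hWh, hWl, hWm, hWlen⟩ := ih (by omega)
    rw [← add_assoc] at hj ⊢
    set j := i + e with hjdef
    have hy := h.y_lt j (by omega)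
    have hy' := h.y_lt (j + 1) hj
    have hyn := h.y_le_n (i := j + 1 + 1) (by omega)
    have hX := h.X_lt (j + 1) hj
    have hyX := h.le_X j (by omega)
    -- Extend the path to where the next member starts, reverse it, and prepend that member.
    have hsub := isChain_append_pathSegment h.adj hW.1 hWl hyX (by omega)
    obtain ⟨D, hD⟩ : ∃ D, (W ++ pathSegment v (y j) (X (j + 1))).reverse =
        v (X (j + 1)) :: D := by
      have : (W ++ pathSegment v (y j) (X (j + 1))).reverse.head? = some (v (X (j + 1))) := by
        rw [List.head?_reverse, hsub.2]
      exact ⟨_, List.eq_cons_of_mem_head? this⟩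
    have hDm : ∀ z ∈ v (X (j + 1)) :: D, (∃ k ≤ y (j + 1), z = v k) ∨ ∃ k ≤ j, z ∈ Q k := by
      intro z hz
      rw [← hD] at hz
      simp only [List.mem_reverse, List.mem_append, mem_pathSegment] at hz
      rcases hz with hz | ⟨k, -, hk, rfl⟩
      · rcases hWm z hz with ⟨k, hk, rfl⟩ | rfl | hz
        · exact .inl ⟨k, by omega, rfl⟩
        · exact .inl ⟨_, le_rfl, rfl⟩
        · exact .inr hz
      · exact .inl ⟨k, by omega, rfl⟩
    have hDn : (v (X (j + 1)) :: D).Nodup := by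
      rw [← hD, List.nodup_reverse, List.nodup_append]
      refine ⟨hW.2, nodup_pathSegment h.inj (by omega), fun a ha b hb => ?_⟩
      obtain ⟨k, hk₁, hk₂, rfl⟩ := mem_pathSegment.1 hb
      rcases hWm a ha with ⟨k', hk', rfl⟩ | rfl | ⟨k', hk', hz⟩
      · intro he
        have := h.inj (by simp; omega) (by simp; omega) he
        omega
      · intro he
        have := h.inj (by simp; omega) (by simp; omega) he
        omega
      · exact h.off k' (by omega) a hz k (by omega)
    have hDl := congrArg List.length hD
    refine ⟨v (y (j + 1 + 1)) :: ((Q (j + 1)).reverse ++ v (X (j + 1)) :: D), ⟨?_, ?_⟩,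
      by simp, ?_, ?_, ?_⟩
    · rw [← List.cons_append, List.isChain_split]
      refine ⟨hrev (j + 1) hj, ?_⟩
      rw [← hD, isChain_adj_reverse]
      exact hsub.1
    · rw [List.nodup_cons, List.nodup_append]
      refine ⟨?_, List.nodup_reverse.2 (h.nodup _ hj), hDn, ?_⟩
      · rw [List.mem_append, List.mem_reverse]
        rintro (hz | hz)
        · exact h.off _ hj _ hz _ hyn rfl
        · rcases hDm _ hz with ⟨k, hk, he⟩ | ⟨k, hk, hz⟩
          · have := h.inj (by simpa using hyn) (by simp; omega) he
            omega
          · exact h.off k (by omega) _ hz _ hyn rfl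
      · intro a ha b hb hab
        subst hab
        rw [List.mem_reverse] at ha
        rcases hDm _ hb with ⟨k, hk, rfl⟩ | ⟨k, hk, hz⟩
        · exact h.off _ hj _ ha k (by omega) rfl
        · exact h.disj k (j + 1) (by omega) hj hz ha
    · rw [← List.cons_append, List.getLast?_append_cons, ← hD, List.getLast?_reverse,
        List.head?_append_of_ne_nil _ (by rintro rfl; simp at hWh), hWh]
    · intro z hz
      rw [List.mem_cons, List.mem_append, List.mem_reverse] at hz
      rcases hz with rfl | hz | hz
      · exact .inr (.inl rfl)
      · exact .inr (.inr ⟨_, le_rfl, hz⟩)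
      · rcases hDm _ hz with h' | ⟨k, hk, h'⟩
        · exact .inl h'
        · exact .inr (.inr ⟨k, by omega, h'⟩)
    · rw [vineSum_succ]
      simp at hDl ⊢
      omega

/-- The cycle through members `i, …, j - 1` uses the overlaps at both extremes, the singly covered
segments between them, and at least one edge of each member. -/
theorem add_le_circumference [Fintype V] (h : IsVine G v n m X y Q) {i j : ℕ} (hij : i < j)
    (hj : j ≤ m) : (y i - X i) + (y j - X j) + (j - i) + vineSum X y j ≤
      G.circumference + vineSum X y i := by
  obtain ⟨e, rfl⟩ := Nat.exists_eq_add_of_lt hij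
  obtain ⟨W, hW, hWh, hWl, hWm, hWlen⟩ := h.exists_isPathList i e (by omega)
  set j := i + e with hjdef
  have hy := h.y_lt j (by omega)
  have hyn := h.y_le_n hj
  have hX := h.X_lt i (by omega)
  have hXj := h.X_le_y hj
  have hXj' := h.le_X j (by omega)
  have hmono := vineSum_mono X y (show i ≤ j by omega)
  -- Stop one vertex early: `v (y (j + 1))` is already the head of `W`.
  have hsub := isChain_append_pathSegment h.adj hW.1 hWl (b := y (j + 1) - 1) (by omega) (by omega)
  have hcyc : G.IsCycleList (W ++ pathSegment v (y j) (y (j + 1) - 1)) := by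
    rw [isCycleList_iff]
    refine ⟨by simp; omega, ⟨hsub.1, ?_⟩, ?_⟩
    · rw [List.nodup_append]
      refine ⟨hW.2, nodup_pathSegment h.inj (by omega), fun a ha b hb => ?_⟩
      obtain ⟨k, hk₁, hk₂, rfl⟩ := mem_pathSegment.1 hb
      rcases hWm a ha with ⟨k', hk', rfl⟩ | rfl | ⟨k', hk', hz⟩
      · intro he
        have := h.inj (by simp; omega) (by simp; omega) he
        omega
      · intro he
        have := h.inj (by simp; omega) (by simp; omega) he
        omega
      · exact h.off k' (by omega) a hz k (by omega)
    · rw [hsub.2, List.head?_append_of_ne_nil _ (by rintro rfl; simp at hWh), hWh]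
      have := h.adj (y (j + 1) - 1) (by omega)
      rw [show y (j + 1) - 1 + 1 = y (j + 1) by omega] at this
      simpa using this
  have := hcyc.length_le_circumference
  rw [vineSum_succ]
  simp at this
  omega

end IsVine

end SimpleGraph

/-! ### Bridges and the greedy vine -/

namespace SimpleGraph

variable {V : Type*} {G : SimpleGraph V} {v : ℕ → V} {n : ℕ}

theorem exists_nodup_isChain (b : V) : ∀ (q : List V) (a : V), (a :: (q ++ [b])).IsChain G.Adj →
    ∃ q', q' ⊆ q ∧ q'.Nodup ∧ (a :: (q' ++ [b])).IsChain G.Adj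
  | [], a, h => ⟨[], by simp, by simp, h⟩
  | x :: q, a, h => by
    rw [List.cons_append, List.isChain_cons_cons] at h
    obtain ⟨q', hsub, hn, hc⟩ := exists_nodup_isChain b q x h.2
    by_cases hx : x ∈ q'
    · obtain ⟨l₁, l₂, rfl⟩ := List.append_of_mem hx
      refine ⟨x :: l₂, fun z hz => ?_, hn.sublist (List.sublist_append_right _ _), ?_⟩
      · rcases List.mem_cons.1 hz with rfl | hz
        · simp
        · exact List.mem_cons_of_mem _ (hsub (by simp [hz]))
      · rw [List.cons_append, List.isChain_cons_cons]
        exact ⟨h.1, hc.of_isInfix ⟨x :: l₁, [], by simp⟩⟩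
    · refine ⟨x :: q', List.cons_subset_cons _ hsub, List.nodup_cons.2 ⟨hx, hn⟩, ?_⟩
      rw [List.cons_append, List.isChain_cons_cons]
      exact ⟨h.1, hc⟩

/-- The vertices `v a` and `v b` are joined by a walk that has no inner vertex among
`v 0, …, v n`. -/
def IsBridged (G : SimpleGraph V) (v : ℕ → V) (n a b : ℕ) : Prop :=
  ∃ q : List V, (v a :: (q ++ [v b])).IsChain G.Adj ∧ ∀ z ∈ q, ∀ i ≤ n, z ≠ v i

theorem isBridged_of_adj {a b : ℕ} (h : G.Adj (v a) (v b)) : IsBridged G v n a b :=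
  ⟨[], by simpa using h, by simp⟩

/-- Splicing at a common inner vertex: this makes the members of a greedy vine disjoint. -/
theorem isBridged_of_mem {a b a' b' : ℕ} {q q' : List V} {z : V}
    (hq : (v a :: (q ++ [v b])).IsChain G.Adj) (hq' : (v a' :: (q' ++ [v b'])).IsChain G.Adj)
    (hoff : ∀ z ∈ q, ∀ i ≤ n, z ≠ v i) (hoff' : ∀ z ∈ q', ∀ i ≤ n, z ≠ v i) (hz : z ∈ q)
    (hz' : z ∈ q') : IsBridged G v n a b' := by
  obtain ⟨l₁, l₂, rfl⟩ := List.append_of_mem hz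
  obtain ⟨l₃, l₄, rfl⟩ := List.append_of_mem hz'
  refine ⟨l₁ ++ z :: l₄, ?_, ?_⟩
  · rw [List.append_assoc, List.cons_append, ← List.cons_append, List.isChain_split]
    exact ⟨hq.of_isInfix ⟨[], l₂ ++ [v b], by simp⟩, hq'.of_isInfix ⟨v a' :: l₃, [], by simp⟩⟩
  · intro w hw
    rcases List.mem_append.1 hw with hw | hw
    · exact hoff w (by simp [hw])
    · exact hoff' w (List.mem_append_right _ hw)

theorem exists_isBridged (hG : G.IsVertexConnected 2) (hv : Set.InjOn v (Set.Iic n)) {i : ℕ}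
    (hi : 0 < i) (hin : i < n) : ∃ a < i, ∃ b, i < b ∧ b ≤ n ∧ IsBridged G v n a b := by
  by_contra! hcon
  -- `S` is what can be reached from before `v i` without passing through `v i` or any later path
  -- vertex; an edge leaving `S` away from `v i` ends a bridge over `v i`.
  let S : Set V := {z | (∃ a < i, z = v a) ∨ ((∀ k ≤ n, z ≠ v k) ∧ ∃ a < i, ∃ q : List V,
    (v a :: (q ++ [z])).IsChain G.Adj ∧ ∀ z ∈ q, ∀ i ≤ n, z ≠ v i)}
  have hn : v n ∉ S := by
    rintro (⟨a, ha, he⟩ | ⟨h, -⟩)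
    · have := hv (by simp) (by simp; omega) he
      omega
    · exact h n le_rfl rfl
  have h0 : v 0 ≠ v i := fun he => by
    have := hv (by simp) (by simp; omega) he
    omega
  have hni : v n ≠ v i := fun he => by
    have := hv (by simp) (by simp; omega) he
    omega
  obtain ⟨x, hx, z, hz, -, hza, hxz⟩ := hG.exists_adj (v i) S (x := v 0) (.inl ⟨0, hi, rfl⟩) h0 hn
    hni
  obtain ⟨a, ha, q, hq, hoff⟩ : ∃ a < i, ∃ q : List V, (v a :: (q ++ [z])).IsChain G.Adj ∧
      ∀ z ∈ q, ∀ i ≤ n, z ≠ v i := by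
    rcases hx with ⟨a, ha, rfl⟩ | ⟨hx, a, ha, q, hq, hoff⟩
    · exact ⟨a, ha, [], by simpa using hxz, by simp⟩
    · refine ⟨a, ha, q ++ [x], ?_, ?_⟩
      · rw [List.append_assoc, List.singleton_append, ← List.cons_append, List.isChain_split]
        exact ⟨hq, by simpa using hxz⟩
      · intro w hw
        rcases List.mem_append.1 hw with hw | hw
        · exact hoff w hw
        · rwa [List.mem_singleton.1 hw]
  by_cases hzP : ∃ k ≤ n, z = v k
  · obtain ⟨k, hk, rfl⟩ := hzP
    rcases lt_trichotomy k i with hlt | rfl | hlt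
    · exact hz (.inl ⟨k, hlt, rfl⟩)
    · exact hza rfl
    · exact hcon a ha k hlt hk ⟨q, hq, hoff⟩
  · exact hz (.inr ⟨fun k hk he => hzP ⟨k, hk, he⟩, a, ha, q, hq, hoff⟩)

/-- The greedy vine on a path of a 2-connected graph. -/
theorem exists_isVine (hG : G.IsVertexConnected 2) (hv : Set.InjOn v (Set.Iic n))
    (hadj : ∀ i < n, G.Adj (v i) (v (i + 1))) (hn : 2 ≤ n) :
    ∃ m X y Q, IsVine G v n m X y Q ∧ 1 ≤ m ∧ (∀ b ≤ n, G.Adj (v 0) (v b) → b ≤ y 1) ∧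
      (2 ≤ m → ∀ a, G.Adj (v a) (v n) → y (m - 2) ≤ a) := by
  classical
  -- `F i` is the furthest index bridged from before `i`; the vine iterates `F` from `1`.
  let F : ℕ → ℕ := fun i => Nat.findGreatest (fun b => ∃ a < i, IsBridged G v n a b) n
  have hFn : ∀ i, F i ≤ n := fun i => Nat.findGreatest_le n
  have hF : ∀ {i a b}, a < i → b ≤ n → IsBridged G v n a b → b ≤ F i := fun ha hb h =>
    Nat.le_findGreatest hb ⟨_, ha, h⟩
  have hlt : ∀ i, 0 < i → i < n → i < F i := by
    intro i hi hin
    obtain ⟨a, ha, b, hib, hbn, hab⟩ := exists_isBridged hG hv hi hin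
    exact hib.trans_le (hF ha hbn hab)
  have hspec : ∀ i, 0 < i → i < n → ∃ a < i, IsBridged G v n a (F i) := by
    intro i hi hin
    obtain ⟨a, ha, b, hib, hbn, hab⟩ := exists_isBridged hG hv hi hin
    exact Nat.findGreatest_spec (P := fun b => ∃ a < i, IsBridged G v n a b) hbn ⟨a, ha, hab⟩
  let y : ℕ → ℕ := fun k => F^[k] 1
  have hy : ∀ k, y (k + 1) = F (y k) := fun k => Function.iterate_succ_apply' F k 1
  have hyn : ∀ k, y k ≤ n := fun k => by
    cases k with
    | zero => change 1 ≤ n; omega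
    | succ k => rw [hy]; exact hFn _
  have hypos : ∀ k, 0 < y k ∧ (k < y k ∨ y k = n) := fun k => by
    induction k with
    | zero => exact ⟨Nat.one_pos, .inl Nat.one_pos⟩
    | succ k ih =>
      rw [hy]
      rcases (hyn k).lt_or_eq with h | h
      · have := hlt _ ih.1 h
        exact ⟨by omega, .inl (by omega)⟩
      · obtain ⟨a, ha, b, hb, hbn, hab⟩ := exists_isBridged hG hv (i := n - 1) (by omega) (by omega)
        have : n ≤ F (y k) := hF (a := a) (by omega) le_rfl (by
          obtain rfl : b = n := by omega
          exact hab)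
        have := hFn (y k)
        exact ⟨by omega, .inr (by omega)⟩
  have hex : ∃ m, y m = n := ⟨n, by have := (hypos n).2; have := hyn n; omega⟩
  set m := Nat.find hex with hm
  have hym : y m = n := Nat.find_spec hex
  have hlt' : ∀ k < m, y k < n := fun k hk => (hyn k).lt_of_ne (Nat.find_min hex hk)
  have hstep : ∀ k < m, y k < y (k + 1) := fun k hk => by
    rw [hy]; exact hlt _ (hypos k).1 (hlt' k hk)
  have hm1 : 1 ≤ m := by
    rw [Nat.one_le_iff_ne_zero]
    intro h0
    rw [h0] at hym
    change 1 = n at hym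
    omega
  have hchoose : ∀ k, ∃ x, ∃ q : List V, k < m → x < y k ∧ q.Nodup ∧
      (v x :: (q ++ [v (y (k + 1))])).IsChain G.Adj ∧ ∀ z ∈ q, ∀ i ≤ n, z ≠ v i := by
    intro k
    by_cases hk : k < m
    · obtain ⟨x, hx, q, hq, hoff⟩ := hspec (y k) (hypos k).1 (hlt' k hk)
      obtain ⟨q', hsub, hn', hc⟩ := exists_nodup_isChain _ q _ hq
      exact ⟨x, q', fun _ => ⟨hx, hn', by rwa [hy], fun z hz => hoff z (hsub hz)⟩⟩
    · exact ⟨0, [], fun h => (hk h).elim⟩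
  choose X Q hXQ using hchoose
  have hbr : ∀ k < m, IsBridged G v n (X k) (y (k + 1)) := fun k hk =>
    ⟨Q k, (hXQ k hk).2.2.1, (hXQ k hk).2.2.2⟩
  have hmono : ∀ j k, j ≤ k → k ≤ m → y j ≤ y k := by
    intro j k hjk
    induction k, hjk using Nat.le_induction with
    | base => simp
    | succ k _ ih => intro hk; exact (ih (by omega)).trans (hstep k (by omega)).le
  refine ⟨m, fun k => if k < m then X k else n, y, Q, ⟨hv, hadj, rfl, ?_, hym, by simp, ?_, ?_,
    hstep, ?_, fun k hk => (hXQ k hk).2.2.2, fun k hk => (hXQ k hk).2.1, ?_⟩, hm1, ?_, ?_⟩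
  · simp only [show 0 < m by omega, if_true]
    have := (hXQ 0 (by omega)).1
    change X 0 < 1 at this
    omega
  · intro k hk
    simp only [hk, if_true]
    exact (hXQ k hk).1
  · intro k hk
    split_ifs with hk'
    -- A member starting before `y k` would have had its end reached one step earlier.
    · by_contra! hlt''
      have := hF hlt'' (hyn _) (hbr (k + 1) hk')
      rw [← hy] at this
      have := hstep (k + 1) hk'
      omega
    · exact hyn k
  · intro k hk
    simp only [hk, if_true]
    exact (hXQ k hk).2.2.1
  · intro j k hjk hk z hzj hzk
    -- Intersecting members would let step `j` reach `y (k + 1)`, beyond the maximal `y (j + 1)`.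
    have hb := isBridged_of_mem (hXQ j (by omega)).2.2.1 (hXQ k hk).2.2.1
      (hXQ j (by omega)).2.2.2 (hXQ k hk).2.2.2 hzj hzk
    have := hF (hXQ j (by omega)).1 (hyn _) hb
    rw [← hy] at this
    have := hstep k hk
    have := hmono (j + 1) k (by omega) (by omega)
    omega
  · intro b hb hadj'
    have := hF (i := y 0) Nat.one_pos hb (isBridged_of_adj hadj')
    rwa [← hy] at this
  · intro h2 a ha
    by_contra! hlt''
    have := hF hlt'' le_rfl (isBridged_of_adj ha)
    rw [← hy] at this
    have := hlt' (m - 2 + 1) (by omega)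
    omega

end SimpleGraph

/-! ### Adjusting the vine and counting nested cycles -/

namespace SimpleGraph

variable {V : Type*} {G : SimpleGraph V} {v : ℕ → V} {n : ℕ}

theorem degree_le_card_of_adj_imp [Fintype V] [DecidableRel G.Adj] {x : V} {I : Finset ℕ}
    (h : ∀ z, G.Adj x z → ∃ i ∈ I, z = v i) : G.degree x ≤ I.card := by
  classical
  rw [← card_neighborFinset_eq_degree]
  refine (Finset.card_le_card (t := I.image v) fun z hz => ?_).trans Finset.card_image_le
  obtain ⟨i, hi, rfl⟩ := h z (by simpa using hz)
  exact Finset.mem_image_of_mem v hi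

/-- Moving the far end of the first member and the near end of the last member of a vine to other
neighbours of the ends of the path, so that the cycle through all members contains all these
neighbours. -/
theorem IsVine.exists_le_vineSum [Fintype V] [DecidableRel G.Adj] {m δ : ℕ} {X y : ℕ → ℕ}
    {Q : ℕ → List V} (h : IsVine G v n m X y Q) (hm : 3 ≤ m) (hδ : ∀ x, δ ≤ G.degree x)
    (hfirst : ∀ z, G.Adj (v 0) z → ∃ i ≤ n, z = v i)
    (hlast : ∀ z, G.Adj (v n) z → ∃ i ≤ n, z = v i)
    (hy₁ : ∀ b ≤ n, G.Adj (v 0) (v b) → b ≤ y 1)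
    (hyₘ : ∀ a, G.Adj (v a) (v n) → y (m - 2) ≤ a) :
    ∃ X' y', IsVine G v n m X' y' Q ∧ 2 * δ ≤ vineSum X' y' m + 3 := by
  classical
  obtain ⟨l, rfl⟩ : ∃ l, m = l + 3 := ⟨m - 3, by omega⟩
  rw [show l + 3 - 2 = l + 1 by omega] at hyₘ
  -- Neighbours of the path's ends lie on the path, so the two outer members are single edges.
  have hQ0 : Q 0 = [] := by
    rcases hq : Q 0 with _ | ⟨z, q⟩
    · rfl
    · have hc := h.chain 0 (by omega)
      rw [hq, List.cons_append, List.isChain_cons_cons, h.X_zero] at hc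
      obtain ⟨i, hi, rfl⟩ := hfirst z hc.1
      exact (h.off 0 (by omega) _ (by simp [hq]) i hi rfl).elim
  have hQl : Q (l + 2) = [] := by
    rcases List.eq_nil_or_concat' (Q (l + 2)) with hq | ⟨q, z, hq⟩
    · exact hq
    · have hc := h.chain (l + 2) (by omega)
      rw [hq, h.y_last] at hc
      have := hc.of_isInfix (l₁ := [z, v n]) ⟨v (X (l + 2)) :: q, [], by simp⟩
      obtain ⟨i, hi, rfl⟩ := hlast z (by simpa using this.rel.symm)
      exact (h.off (l + 2) (by omega) _ (by simp [hq]) i hi rfl).elim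
  have a₀ : G.Adj (v 0) (v (y 1)) := by
    have hc := h.chain 0 (by omega)
    rw [hQ0, h.X_zero] at hc
    simpa using hc
  have aₘ : G.Adj (v n) (v (X (l + 2))) := by
    have hc := h.chain (l + 2) (by omega)
    rw [hQl, h.y_last] at hc
    simpa using hc.rel.symm
  have hX1 := h.X_lt 1 (by omega)
  have hXl := h.X_lt (l + 2) (by omega)
  have hylX : y (l + 1) ≤ X (l + 2) := h.le_X (l + 1) (by omega)
  have hy1X : y 1 ≤ X 2 := h.le_X 1 (by omega)
  have hyln : y (l + 2) < n := h.y_last ▸ h.y_lt (l + 2) (by omega)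
  have hy12 : y 1 < y 2 := h.y_lt 1 (by omega)
  have hy1n := h.y_le_n (i := 1) (by omega)
  have hy1l := h.y_le (i := 1) (j := l + 1) (by omega) (by omega)
  have hX01 : y 0 ≤ X 1 := h.le_X 0 (by omega)
  rw [h.y_zero] at hX01
  -- the new ends
  have hexb : ∃ b, X 1 < b ∧ G.Adj (v 0) (v b) := ⟨_, hX1, a₀⟩
  set b := Nat.find hexb with hbdef
  obtain ⟨hbX, hba⟩ : X 1 < b ∧ G.Adj (v 0) (v b) := Nat.find_spec hexb
  have hby : b ≤ y 1 := Nat.find_min' hexb ⟨hX1, a₀⟩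
  have hbmin : ∀ i, X 1 < i → G.Adj (v 0) (v i) → b ≤ i := fun i h₁ h₂ =>
    Nat.find_min' hexb ⟨h₁, h₂⟩
  set a := Nat.findGreatest (fun i => i < y (l + 2) ∧ G.Adj (v n) (v i)) n with hadef
  obtain ⟨hay, haa⟩ : a < y (l + 2) ∧ G.Adj (v n) (v a) :=
    Nat.findGreatest_spec (P := fun i => i < y (l + 2) ∧ G.Adj (v n) (v i))
      (m := X (l + 2)) (by omega) ⟨hXl, aₘ⟩
  have hamax : ∀ i, i < y (l + 2) → G.Adj (v n) (v i) → i ≤ a := fun i h₁ h₂ =>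
    Nat.le_findGreatest (by omega) ⟨h₁, h₂⟩
  have hXa : X (l + 2) ≤ a := hamax _ hXl aₘ
  set X' := Function.update X (l + 2) a with hX'
  set y' := Function.update y 1 b with hy'
  have eX : ∀ k, k ≠ l + 2 → X' k = X k := fun k hk => Function.update_of_ne hk _ _
  have eX' : X' (l + 2) = a := Function.update_self _ _ _
  have ey : ∀ k, k ≠ 1 → y' k = y k := fun k hk => Function.update_of_ne hk _ _
  have ey' : y' 1 = b := Function.update_self _ _ _
  have hvine : IsVine G v n (l + 3) X' y' Q := by
    refine ⟨h.inj, h.adj, ?_, ?_, ?_, ?_, ?_, ?_, ?_, ?_, h.off, h.nodup, h.disj⟩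
    · rw [ey 0 (by omega), h.y_zero]
    · rw [eX 0 (by omega), h.X_zero]
    · rw [ey _ (by omega), h.y_last]
    · rw [eX _ (by omega), h.X_last]
    · intro k hk
      have := h.X_lt k hk
      rcases eq_or_ne k 1 with rfl | h1
      · rw [ey', eX _ (by omega)]; exact hbX
      · rw [ey k h1]
        rcases eq_or_ne k (l + 2) with rfl | h2
        · rwa [eX']
        · rwa [eX k h2]
    · intro k hk
      have h₁ := h.le_X k hk
      have h₂ : X (k + 1) ≤ X' (k + 1) := by
        rcases eq_or_ne (k + 1) (l + 2) with h2 | h2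
        · rw [h2, eX']; exact hXa
        · rw [eX _ h2]
      have h₃ : y' k ≤ y k := by
        rcases eq_or_ne k 1 with rfl | h1
        · rwa [ey']
        · rw [ey k h1]
      omega
    · intro k hk
      have := h.y_lt k hk
      rcases eq_or_ne k 1 with rfl | h1
      · rw [ey', ey _ (by omega)]; omega
      · rw [ey k h1]
        rcases eq_or_ne k 0 with rfl | h0
        · rw [h.y_zero, zero_add, ey']; omega
        · rwa [ey _ (by omega)]
    · intro k hk
      rcases eq_or_ne k 0 with rfl | h0
      · rw [hQ0, eX _ (by omega), h.X_zero, zero_add, ey']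
        simpa using hba
      · rw [ey _ (by omega)]
        rcases eq_or_ne k (l + 2) with rfl | h2
        · rw [hQl, eX', h.y_last]
          simpa using haa.symm
        · rw [eX _ h2]
          exact h.chain k hk
  refine ⟨X', y', hvine, ?_⟩
  have d₀ := (hδ (v 0)).trans (degree_le_card_of_adj_imp (v := v)
    (I := Finset.Icc 1 (X 1) ∪ Finset.Icc b (y 1)) fun z hz => by
      obtain ⟨i, hi, rfl⟩ := hfirst z hz
      refine ⟨i, ?_, rfl⟩
      have hi0 : i ≠ 0 := by rintro rfl; exact hz.ne rfl
      have := hy₁ i hi hz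
      rw [Finset.mem_union, Finset.mem_Icc, Finset.mem_Icc]
      rcases le_or_gt i (X 1) with hle | hlt
      · exact .inl ⟨by omega, hle⟩
      · exact .inr ⟨hbmin i hlt hz, this⟩)
  have dₘ := (hδ (v n)).trans (degree_le_card_of_adj_imp (v := v)
    (I := Finset.Icc (y (l + 1)) a ∪ Finset.Ico (y (l + 2)) n) fun z hz => by
      obtain ⟨i, hi, rfl⟩ := hlast z hz
      refine ⟨i, ?_, rfl⟩
      have hin : i ≠ n := by rintro rfl; exact hz.ne rfl
      have := hyₘ i hz.symm
      rw [Finset.mem_union, Finset.mem_Icc, Finset.mem_Ico]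
      rcases lt_or_ge i (y (l + 2)) with hlt | hle
      · exact .inl ⟨this, hamax i hlt hz⟩
      · exact .inr ⟨hle, by omega⟩)
  replace d₀ := d₀.trans (Finset.card_union_le _ _)
  replace dₘ := dₘ.trans (Finset.card_union_le _ _)
  simp only [Nat.card_Icc, Nat.card_Ico] at d₀ dₘ
  have s₁ : vineSum X' y' 1 = X 1 - 1 := by
    simp [vineSum, eX 1 (by omega), ey 0 (by omega), h.y_zero]
  have s₂ : vineSum X' y' 2 = vineSum X' y' 1 + (X' 2 - b) := by rw [← ey', vineSum_succ]
  have s₃ : vineSum X' y' (l + 2) = vineSum X' y' (l + 1) + (a - y' (l + 1)) := by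
    rw [← eX', vineSum_succ]
  have s₄ : vineSum X' y' (l + 3) = vineSum X' y' (l + 2) + (n - y (l + 2)) := by
    rw [vineSum_succ, eX _ (by omega), ey _ (by omega), h.X_last]
  rcases Nat.eq_zero_or_pos l with rfl | hl
  · simp only [zero_add] at *
    rw [ey'] at s₃
    omega
  · rw [eX 2 (by omega)] at s₂
    rw [ey (l + 1) (by omega)] at s₃
    have := vineSum_mono X' y' (show 2 ≤ l + 1 by omega)
    omega

/-- The total length of the first `k` segments of the path that are covered twice by a vine. -/
def vineOverlap (X y : ℕ → ℕ) (k : ℕ) : ℕ :=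
  ∑ l ∈ Finset.range k, (y (l + 1) - X (l + 1))

theorem vineOverlap_succ (X y : ℕ → ℕ) (k : ℕ) :
    vineOverlap X y (k + 1) = vineOverlap X y k + (y (k + 1) - X (k + 1)) :=
  Finset.sum_range_succ _ _

/-- At `k = m` this splits the path into singly and doubly covered segments; the `1` is the initial
edge before `y 0`. -/
theorem IsVine.y_eq {m : ℕ} {X y : ℕ → ℕ} {Q : ℕ → List V} (h : IsVine G v n m X y Q) {k : ℕ}
    (hk : k ≤ m) : y k = 1 + vineSum X y k + vineOverlap X y k := by
  induction k with
  | zero => simp [h.y_zero, vineSum, vineOverlap]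
  | succ k ih =>
    rw [vineSum_succ, vineOverlap_succ]
    have := ih (by omega)
    have := h.X_le_y hk
    have := h.le_X k (by omega)
    omega

theorem IsVine.length_le_of_odd [Fintype V] {r : ℕ} {X y : ℕ → ℕ} {Q : ℕ → List V}
    (h : IsVine G v n (2 * r + 1) X y Q) :
    n + 1 + 2 * r + r * r ≤ (r + 1) * G.circumference := by
  -- Members `r - e, …, r + e` give a cycle bounding two overlaps plus `2e + 1`; the odd numbers sum
  -- to a square.
  have key : ∀ e ≤ r, vineOverlap X y (r + e) + e * e ≤
      vineOverlap X y (r - e) + e * G.circumference := by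
    intro e
    induction e with
    | zero => simp
    | succ e ih =>
      intro he
      have h₁ := ih (by omega)
      have h₂ := h.add_le_circumference (i := r - e) (j := r + e + 1) (by omega) (by omega)
      have h₃ := vineSum_mono X y (show r - e ≤ r + e + 1 by omega)
      have h₄ := vineOverlap_succ X y (r + e)
      have h₅ := vineOverlap_succ X y (r - (e + 1))
      rw [show r - (e + 1) + 1 = r - e by omega] at h₅
      rw [← add_assoc, h₄, add_mul, one_mul, add_mul, mul_add]
      omega
  have h₁ := key r le_rfl
  have h₂ := h.add_le_circumference (i := 0) (j := 2 * r + 1) (by omega) le_rfl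
  have h₃ := h.y_eq le_rfl
  have h₄ := vineOverlap_succ X y (2 * r)
  rw [h.X_zero, h.y_zero] at h₂
  rw [h.X_last, h.y_last] at h₂ h₄
  rw [h.y_last] at h₃
  rw [← two_mul, Nat.sub_self] at h₁
  have h₅ : vineOverlap X y 0 = 0 := rfl
  have h₆ : vineSum X y 0 = 0 := rfl
  rw [add_mul, one_mul]
  omega

theorem IsVine.two_mul_length_le_of_even [Fintype V] {r : ℕ} (hr : 1 ≤ r) {X y : ℕ → ℕ}
    {Q : ℕ → List V} (h : IsVine G v n (2 * r) X y Q) :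
    2 * (n + 1) + 2 * r + 2 * (r * r) ≤ (2 * r + 1) * G.circumference + 2 := by
  obtain ⟨r, rfl⟩ := Nat.exists_eq_add_of_le' hr
  -- Now the middle overlap has no partner, and the other pairs contribute the even numbers `2e +
  -- 2`.
  have key : ∀ e ≤ r, vineOverlap X y (r + e + 1) + e * (e + 1) ≤
      vineOverlap X y (r - e) + (y (r + 1) - X (r + 1)) + e * G.circumference := by
    intro e
    induction e with
    | zero => simp [vineOverlap_succ]
    | succ e ih =>
      intro he
      have h₁ := ih (by omega)
      have h₂ := h.add_le_circumference (i := r - e) (j := r + e + 2) (by omega) (by omega)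
      have h₃ := vineSum_mono X y (show r - e ≤ r + e + 2 by omega)
      have h₄ := vineOverlap_succ X y (r + e + 1)
      have h₅ := vineOverlap_succ X y (r - (e + 1))
      rw [show r - (e + 1) + 1 = r - e by omega] at h₅
      rw [← add_assoc, h₄]
      ring_nf at h₁ h₂ h₃ h₅ ⊢
      rw [show 2 + r + e = r + e + 2 by omega] at *
      omega
  have h₁ := key r le_rfl
  -- The cycles through the two halves of the vine both contain the middle overlap; adding their
  -- bounds controls twice its length.
  have h₂ := h.add_le_circumference (i := 0) (j := r + 1) (by omega) (by omega)
  have h₂' := h.add_le_circumference (i := r + 1) (j := 2 * (r + 1)) (by omega) (by omega)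
  have hall := h.add_le_circumference (i := 0) (j := 2 * (r + 1)) (by omega) (by omega)
  have h₃ := h.y_eq le_rfl
  have h₄ := vineOverlap_succ X y (r + r + 1)
  rw [show r + r + 1 + 1 = 2 * (r + 1) by omega] at h₄
  rw [h.X_zero, h.y_zero] at h₂ hall
  rw [h.X_last, h.y_last] at h₂' h₄ hall
  rw [h.y_last] at h₃
  rw [Nat.sub_self] at h₁
  have h₅ : vineOverlap X y 0 = 0 := rfl
  have h₆ : vineSum X y 0 = 0 := rfl
  have h₇ : (2 * (r + 1) + 1) * G.circumference =
    2 * (r * G.circumference) + 3 * G.circumference := by ring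
  have h₈ : (r + 1) * (r + 1) = r * (r + 1) + r + 1 := by ring
  rw [h₇, h₈]
  omega

end SimpleGraph

/-! ### The circumference bounds -/

namespace SimpleGraph

variable {V : Type*} {G : SimpleGraph V}

theorem circumference_bounds [Fintype V] [DecidableRel G.Adj] (hG : G.IsVertexConnected 2) :
    (G.longestPathOrder ≤ G.circumference ∨ 2 * G.minDegree ≤ G.circumference) ∧
      (G.longestPathOrder ≤ G.circumference + 1 ∨
        3 * G.minDegree ≤ G.longestPathOrder + 1) := by
  have hne : Nonempty V := by
    have := hG.1
    rw [Nat.card_eq_fintype_card] at this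
    exact Fintype.card_pos_iff.1 (by omega)
  obtain ⟨C, R, h, hlen⟩ := exists_isMaxLollipop (G := G) hG.two_le_degree
  have hC := h.cycle.length_le_circumference
  rw [← hlen, List.length_append]
  have hδ := G.minDegree_le_degree
  constructor
  · rcases eq_or_ne R [] with rfl | hR
    · exact .inl (by simpa using hC)
    · exact .inr ((h.two_mul_le_length hG hδ hR).trans hC)
  · rcases lt_or_ge R.length 2 with hR | hR
    · exact .inl (by omega)
    · refine .inr ?_
      have := h.three_mul_le hG hδ hR
      rwa [List.length_append] at this

/-- A 2-connected graph with circumference less than twice the minimum degree is Hamiltonian. -/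
theorem card_le_circumference [Fintype V] [DecidableRel G.Adj] (hG : G.IsVertexConnected 2)
    (hlt : G.circumference < 2 * G.minDegree) : Fintype.card V ≤ G.circumference := by
  classical
  have hne : Nonempty V := by
    have := hG.1
    rw [Nat.card_eq_fintype_card] at this
    exact Fintype.card_pos_iff.1 (by omega)
  obtain ⟨C, R, h, -⟩ := exists_isMaxLollipop (G := G) hG.two_le_degree
  have hC := h.cycle.length_le_circumference
  obtain rfl : R = [] := by
    by_contra hR
    have := h.two_mul_le_length hG G.minDegree_le_degree hR
    omega
  have h3 := h.cycle.1
  suffices ∀ z, z ∈ C by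
    refine le_trans ?_ hC
    rw [← List.toFinset_card_of_nodup h.cycle.2.1, ← Finset.card_univ]
    exact Finset.card_le_card fun z _ => by simpa using this z
  by_contra! hz
  obtain ⟨z, hz⟩ := hz
  obtain ⟨a, b, C', rfl⟩ : ∃ a b C', C = a :: b :: C' := by
    match C with
    | [] => simp at h3
    | [_] => simp at h3
    | a :: b :: C' => exact ⟨a, b, C', rfl⟩
  have hab : a ≠ b := by
    have := h.cycle.2.1
    simp at this
    tauto
  obtain ⟨u, hu, w, hw, -, -, huw⟩ := hG.exists_adj a {x | x ∈ a :: b :: C'} (x := b) (y := z)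
    (by simp) hab.symm hz (by rintro rfl; simp at hz)
  obtain ⟨l₁, l₂, hl⟩ := List.append_of_mem hu
  have hcyc : G.IsCycleList (u :: l₂ ++ l₁) := IsCycleList.append_comm (hl ▸ h.cycle)
  have hlen := congrArg List.length hl
  have hmax := h.length_le (w :: (u :: l₂ ++ l₁)) ⟨by
      rw [List.cons_append, List.isChain_cons_cons]
      exact ⟨huw.symm, hcyc.isPathList.1⟩, by
      rw [List.nodup_cons]
      refine ⟨fun hm => hw ?_, hcyc.2.1⟩
      rw [Set.mem_ofPred_eq, hl]
      simp at hm ⊢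
      tauto⟩
  simp at hmax hlen
  omega

/-- The right side increases from `p` to `c`, and at `c = p` the inequality follows from `p ≥ 3δ -
1`. -/
theorem circumference_quadratic_of_longestPathOrder_le {p c δ : ℤ} (hδ : 2 ≤ δ) (hpc : p ≤ c)
    (hp : 3 * δ - 1 ≤ p) : 2 * p ≤ c * (c - 2 * δ - 1) + 8 * δ - 2 := by
  have h₁ : 0 ≤ (c - p) * (c + p - 2 * δ - 1) := mul_nonneg (by omega) (by omega)
  have h₂ : 0 ≤ (p - 3 * δ + 1) * (p + δ - 4) := mul_nonneg (by omega) (by omega)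
  nlinarith [mul_nonneg (show (0 : ℤ) ≤ δ - 2 by omega) (show (0 : ℤ) ≤ δ by omega)]

theorem circumference_quadratic [Fintype V] [DecidableRel G.Adj] (hG : G.IsVertexConnected 2)
    {c p δ : ℕ} (hc : c = G.circumference) (hp : p = G.longestPathOrder) (hδ : δ = G.minDegree)
    (hpδ : (p : ℤ) ≥ 3 * (δ : ℤ) - 1) (hδ2 : 2 ≤ δ) :
    2 * (p : ℤ) ≤ c * (c - 2 * δ - 1) + 8 * δ - 2 := by
  have hne : Nonempty V := by
    have := hG.1
    rw [Nat.card_eq_fintype_card] at this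
    exact Fintype.card_pos_iff.1 (by omega)
  rcases le_or_gt p c with hpc | hcp
  · exact circumference_quadratic_of_longestPathOrder_le (by omega) (by omega) hpδ
  have hcδ : 2 * δ ≤ c := by
    have := (circumference_bounds hG).1
    omega
  obtain ⟨l, hl, hlen⟩ := exists_isPathList_length_eq (G := G)
  have hmax : ∀ l', G.IsPathList l' → l'.length ≤ l.length := fun l' h' =>
    hlen ▸ h'.length_le_longestPathOrder
  rw [← hp] at hlen
  obtain ⟨n, rfl⟩ : ∃ n, p = n + 1 := ⟨p - 1, by omega⟩
  -- Only indices up to `n` matter; beyond them the value is arbitrary.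
  let v : ℕ → V := fun i => l.getD i (Classical.arbitrary V)
  have hv : ∀ i (hi : i < l.length), v i = l[i] := fun i hi => List.getD_eq_getElem _ _ hi
  have hinj : Set.InjOn v (Set.Iic n) := by
    intro i hi j hj hij
    rw [Set.mem_Iic] at hi hj
    rw [hv i (by omega), hv j (by omega)] at hij
    exact (hl.2.getElem_inj_iff).1 hij
  have hadj : ∀ i < n, G.Adj (v i) (v (i + 1)) := by
    intro i hi
    rw [hv i (by omega), hv (i + 1) (by omega)]
    exact List.isChain_iff_getElem.1 hl.1 i (by omega)
  have hmem : ∀ z ∈ l, ∃ i ≤ n, z = v i := by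
    intro z hz
    obtain ⟨i, hi, rfl⟩ := List.mem_iff_getElem.1 hz
    exact ⟨i, by omega, (hv i hi).symm⟩
  have hend : ∀ l' : List V, G.IsPathList l' → l'.length = l.length → (∀ z ∈ l', z ∈ l) →
      ∀ x, l'.head? = some x → ∀ z, G.Adj x z → ∃ i ≤ n, z = v i := by
    intro l' hl' hlen' hsub x hx z hz
    obtain ⟨l'', rfl⟩ : ∃ l'', l' = x :: l'' := ⟨_, List.eq_cons_of_mem_head? hx⟩
    exact hmem z (hsub z (List.mem_cons_of_mem _
      (hl'.mem_of_adj_head (fun l hl => hlen' ▸ hmax l hl) hz)))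
  have hfirst := hend l hl rfl (fun z hz => hz) (v 0) (by
    rw [hv 0 (by omega), List.head?_eq_getElem?, List.getElem?_eq_getElem])
  have hlast := hend l.reverse hl.reverse (by simp) (by simp) (v n) (by
    rw [hv n (by omega), List.head?_reverse, List.getLast?_eq_getElem?,
      List.getElem?_eq_getElem (by omega)]
    congr 2
    omega)
  obtain ⟨m, X, y, Q, hvine, hm, hy₁, hyₘ⟩ := exists_isVine hG hinj hadj (by omega)
  obtain ⟨X, y, hvine, hcm⟩ : ∃ X y, IsVine G v n m X y Q ∧ (3 ≤ m → 2 * δ + m ≤ c + 2) := by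
    rcases lt_or_ge m 3 with hm3 | hm3
    · exact ⟨X, y, hvine, fun h => by omega⟩
    · obtain ⟨X', y', hvine', hS⟩ := hvine.exists_le_vineSum hm3
        (fun x => hδ ▸ G.minDegree_le_degree x) hfirst hlast hy₁ (hyₘ (by omega))
      have := hvine'.add_le_circumference (i := 0) (j := m) (by omega) le_rfl
      rw [hvine'.X_zero, hvine'.y_zero] at this
      have h0 : vineSum X' y' 0 = 0 := rfl
      exact ⟨X', y', hvine', fun _ => by omega⟩
  rcases Nat.even_or_odd' m with ⟨r, rfl | rfl⟩
  · have hbound := hvine.two_mul_length_le_of_even (by omega)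
    rw [← hc] at hbound
    -- For `m = 2` this is just `2δ ≤ c`.
    have hr : 2 * δ + 2 * r ≤ c + 2 := by
      rcases lt_or_ge (2 * r) 3 with h | h
      · omega
      · exact hcm h
    obtain ⟨r, rfl⟩ : ∃ r', r = r' + 1 := ⟨r - 1, by omega⟩
    obtain ⟨e, rfl⟩ : ∃ e, c = 2 * δ + 2 * r + e := ⟨c - 2 * δ - 2 * r, by omega⟩
    obtain ⟨d, rfl⟩ : ∃ d, δ = d + 2 := ⟨δ - 2, by omega⟩
    zify at hbound
    push_cast
    have h₁ : (0 : ℤ) ≤ r * (r - 1) := by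
      rcases r.eq_zero_or_pos with rfl | h
      · simp
      · exact mul_nonneg (by omega) (by omega)
    nlinarith [mul_nonneg (Int.natCast_nonneg e) (Int.natCast_nonneg d),
      mul_nonneg (Int.natCast_nonneg e) (Int.natCast_nonneg r), sq_nonneg (e : ℤ)]
  · have hbound := hvine.length_le_of_odd
    rw [← hc] at hbound
    -- A single member closes the whole path into a cycle, against `c < p`.
    rcases Nat.eq_zero_or_pos r with rfl | hr0
    · omega
    have hr := hcm (by omega)
    obtain ⟨r, rfl⟩ : ∃ r', r = r' + 1 := ⟨r - 1, by omega⟩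
    obtain ⟨e, rfl⟩ : ∃ e, c = 2 * δ + 2 * r + 1 + e := ⟨c - 2 * δ - 2 * r - 1, by omega⟩
    obtain ⟨d, rfl⟩ : ∃ d, δ = d + 2 := ⟨δ - 2, by omega⟩
    zify at hbound
    push_cast
    nlinarith [mul_nonneg (Int.natCast_nonneg e) (Int.natCast_nonneg d),
      mul_nonneg (Int.natCast_nonneg e) (Int.natCast_nonneg r), sq_nonneg (e : ℤ)]

end SimpleGraph

theorem theorem1 {V : Type*} [Fintype V] (G : SimpleGraph V) [DecidableRel G.Adj]
    (hG : G.IsVertexConnected 2) (c p δ : ℕ)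
    (hc : c = G.circumference) (hp : p = G.longestPathOrder) (hδ : δ = G.minDegree) :
    -- the lower bound on the circumference
    ((p ≤ 2 * δ → p ≤ c) ∧
      (2 * δ + 1 ≤ p ∧ (p : ℤ) ≤ 3 * (δ : ℤ) - 2 → (p : ℤ) - 1 ≤ (c : ℤ)) ∧
      ((p : ℤ) ≥ 3 * (δ : ℤ) - 1 →
        √(2 * (p : ℝ) - 10 + ((δ : ℝ) - 7 / 2) ^ 2) + (δ : ℝ) + 1 / 2 ≤ (c : ℝ))) ∧
    -- it yields the degree bound for the circumference
    min (Fintype.card V) (2 * δ) ≤ c ∧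
    -- and in each of the three ranges it is strictly larger than `√(2p)`
    ((p ≤ 2 * δ → √(2 * (p : ℝ)) < (p : ℝ)) ∧
      (2 * δ + 1 ≤ p ∧ (p : ℤ) ≤ 3 * (δ : ℤ) - 2 → √(2 * (p : ℝ)) < (p : ℝ) - 1) ∧
      ((p : ℤ) ≥ 3 * (δ : ℤ) - 1 →
        √(2 * (p : ℝ)) < √(2 * (p : ℝ) - 10 + ((δ : ℝ) - 7 / 2) ^ 2) + (δ : ℝ) + 1 / 2)) := by
  have hne : Nonempty V := by
    have := hG.1
    rw [Nat.card_eq_fintype_card] at this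
    exact Fintype.card_pos_iff.1 (by omega)
  have hδ2 : 2 ≤ δ := hδ ▸ G.le_minDegree_of_forall_le_degree 2 hG.two_le_degree
  obtain ⟨hdirac, hnear⟩ := SimpleGraph.circumference_bounds hG
  obtain ⟨C, R, h, hlen⟩ := SimpleGraph.exists_isMaxLollipop (G := G) hG.two_le_degree
  have hp3 : 3 ≤ p := by
    have := h.cycle.1
    rw [List.length_append] at hlen
    omega
  rw [← hc, ← hp, ← hδ] at hdirac hnear
  refine ⟨⟨fun _ => by omega, fun _ => by omega, fun hpδ => ?_⟩, ?_, fun _ => ?_, fun hr => ?_,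
    fun hpδ => ?_⟩
  · have hq := SimpleGraph.circumference_quadratic hG hc hp hδ hpδ hδ2
    have hcδ : δ + 1 ≤ c := by omega
    -- Squaring turns the claim into the quadratic inequality `hq`.
    rw [add_assoc, ← le_sub_iff_add_le]
    apply Real.sqrt_le_iff.2
    have hcδ' : (δ : ℝ) + 1 ≤ c := by exact_mod_cast hcδ
    have hq' : 2 * (p : ℝ) ≤ c * (c - 2 * δ - 1) + 8 * δ - 2 := by exact_mod_cast hq
    exact ⟨by linarith, by nlinarith⟩
  · rcases lt_or_ge c (2 * δ) with hlt | hge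
    · exact (min_le_left _ _).trans (hc ▸ SimpleGraph.card_le_circumference hG (by omega))
    · exact (min_le_right _ _).trans hge
  · have hp3' : (3 : ℝ) ≤ p := by exact_mod_cast hp3
    rw [Real.sqrt_lt' (by linarith)]
    nlinarith
  · have hp5 : (5 : ℝ) ≤ p := by exact_mod_cast (by omega : 5 ≤ p)
    rw [Real.sqrt_lt' (by linarith)]
    nlinarith
  · have hpδ' : 3 * (δ : ℝ) ≤ p + 1 := by exact_mod_cast (by omega : 3 * δ ≤ p + 1)
    have hδ2' : (2 : ℝ) ≤ δ := by exact_mod_cast hδ2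
    -- At `p = 3δ - 1` the left side is `(δ - 1/2)²`, at least `9/4` since `δ ≥ 2`.
    have harg : 2 * (p : ℝ) - 10 + ((δ : ℝ) - 7 / 2) ^ 2 ≥ 9 / 4 := by nlinarith
    have hs := Real.sq_sqrt (show 0 ≤ 2 * (p : ℝ) - 10 + ((δ : ℝ) - 7 / 2) ^ 2 by linarith)
    have hs1 : 3 / 2 ≤ √(2 * (p : ℝ) - 10 + ((δ : ℝ) - 7 / 2) ^ 2) :=
      Real.le_sqrt_of_sq_le (by linarith)
    rw [Real.sqrt_lt' (by linarith)]
    nlinarith [mul_nonneg (show (0 : ℝ) ≤ δ - 2 by linarith) (show (0 : ℝ) ≤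
      √(2 * (p : ℝ) - 10 + ((δ : ℝ) - 7 / 2) ^ 2) - 3 / 2 by linarith)]
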